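/- Let $(M,\lambda,J)$ be a contact triad: $M$ is a smooth (Hausdorff, $\sigma$-compact) manifold of dimension $2n+1$ without boundary, $\lambda$ is a contact form with Reeb field $R$ and $\xi=\ker\lambda$, and $J$ is a smooth complex structure on $\xi$, extended to $TM$ by $JR=0$, such that $d\lambda(\cdot,J\cdot)$ is symmetric and positive definite on $\xi$. Let $g=d\lambda(\cdot,J\cdot)+\lambda\otimes\lambda$ be the triad metric, $\pi:TM\to\xi$ the projection along $R$, and $c\in\mathbb R$. A smooth affine connection $\nabla$ on $TM$ with torsion $T$ is called *adapted* if $\nabla g=0$, if $\nabla^\pi=\pi\nabla|_\xi$ is a Hermitian connection of $(\xi,g|_\xi,J)$, and if $T(R,\cdot)=0$. It is called a *$c$-contact triad connection* if it is adapted and moreover $\nabla_RR=0$; $\nabla_YR\in\xi$ and $\nabla_{JY}R+J\nabla_YR=cY$ for $Y\in\xi$; and $\pi T(JY,Y)=0$ for $Y\in\xi$. An *almost contact frame* over an open set $U$ is given by smooth sections $E_1,\dots,E_n$ of $\xi|_U$ such that $E_1,\dots,E_n,F_1=JE_1,\dots,F_n=JE_n,R$ is $g$-orthonormal; put $\eta_i=\frac1{\sqrt2}(E_i-\sqrt{-1}F_i)$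 and let $\theta^i,\bar\theta^i,\lambda$ be the coframe dual to $\eta_i,\bar\eta_i,R$. Extend everything complex-linearly and put $\Theta^0=\lambda(T_{\mathbb C})$, $\Theta^i=\theta^i(T_{\mathbb C})$; $\Theta^{\pi(p,q)}$ is the $(p,q)$ part of the restriction of $(\Theta^1,\dots,\Theta^n)$ to $\xi\otimes\mathbb C$. Put $\alpha_k=\theta^k(\nabla R)$, with horizontal part $\alpha_k^\pi=\alpha_k-\alpha_k(R)\lambda$, and $a_k=\lambda(\nabla\eta_k)$, $\bar a_k=\lambda(\nabla\bar\eta_k)$ (so $a_k=-\overline{\alpha_k}$ when $\nabla g=0$); write $(J\cdot\alpha)(Z)=\alpha(JZ)$. The *torsion conditions* in the frame are $$\Theta^0=d\lambda+\sum_{k=1}^n\bigl(a_k\wedge\theta^k+\bar a_k\wedge\bar\theta^k\bigr),\qquad \Theta^{\pi(1,1)}=0,\qquad J\cdot\alpha_k=-\sqrt{-1}\,\alpha_k^\pi+c\,\theta^k .$$ **Theorem.** 1. There is an adapted connection $\nabla$ which satisfies the torsion conditions in every almost contact frame, and every adapted connection that satisfies the torsion conditions in some almost contact frame around each point is equal to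 $\nabla$. 2. A smooth affine connection is adapted and satisfies the torsion conditions in some almost contact frame around each point if and only if it is a $c$-contact triad connection. In particular the $c$-contact triad connection exists and is unique. 3. For a $c$-contact triad connection one also has $\Theta^{\pi(2,0)}=0$, so that $\Theta^\pi$ is of type $(0,2)$. 4. For $c=0$ and an adapted connection, the torsion conditions in a given almost contact frame are equivalent to $$\Theta^0=d\lambda+\sum_{k=1}^n a_k\wedge\theta^k,\qquad \Theta^{\pi(1,1)}=0,\qquad \alpha_k^\pi\ \text{is of type } (0,1)\ \text{for all } k .$$ -/

import Mathlib

open Bundle FiberBundle VectorField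
open scoped Manifold ContDiff TensorProduct

noncomputable section

/-- Model space of a manifold of dimension `2n+1`. -/
abbrev ModelE (n : ℕ) : Type := EuclideanSpace ℝ (Fin (2 * n + 1))

section

variable {n : ℕ} {M : Type*} [TopologicalSpace M] [ChartedSpace (ModelE n) M]

/-- The tangent space of `M` at `x`. -/
abbrev Tan (n : ℕ) {M : Type*} [TopologicalSpace M] [ChartedSpace (ModelE n) M] (x : M) : Type :=
  TangentSpace (𝓡 (2 * n + 1)) x

variable [IsManifold (𝓡 (2 * n + 1)) ∞ M]

/-- Differentiability at `x` of a vector field, as a section of the tangent bundle. -/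
def DiffAt (X : Π x : M, Tan n x) (x : M) : Prop :=
  MDifferentiableAt (𝓡 (2 * n + 1)) ((𝓡 (2 * n + 1)).prod 𝓘(ℝ, ModelE n))
    (fun y ↦ TotalSpace.mk' (ModelE n) (E := (TangentSpace (𝓡 (2 * n + 1)) : M → Type _)) y (X y)) x

/-- Smoothness on the set `U` of a vector field, as a section of the tangent bundle. -/
def SmoothOnSet (X : Π x : M, Tan n x) (U : Set M) : Prop :=
  ContMDiffOn (𝓡 (2 * n + 1)) ((𝓡 (2 * n + 1)).prod 𝓘(ℝ, ModelE n)) ∞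
    (fun y ↦ TotalSpace.mk' (ModelE n) (E := (TangentSpace (𝓡 (2 * n + 1)) : M → Type _)) y (X y)) U

/-- Smoothness of a real one-form, as a section of the cotangent bundle. -/
def SmoothOneForm (lam : Π x : M, Tan n x →L[ℝ] ℝ) : Prop :=
  ContMDiff (𝓡 (2 * n + 1)) ((𝓡 (2 * n + 1)).prod 𝓘(ℝ, ModelE n →L[ℝ] ℝ)) ∞
    (fun x ↦ TotalSpace.mk' (ModelE n →L[ℝ] ℝ) (E := fun x : M ↦ Tan n x →L[ℝ] ℝ) x (lam x))

/-- Smoothness of an endomorphism of the tangent bundle, as a section of `End(TM)`. -/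
def SmoothEndo (J : Π x : M, Tan n x →L[ℝ] Tan n x) : Prop :=
  ContMDiff (𝓡 (2 * n + 1)) ((𝓡 (2 * n + 1)).prod 𝓘(ℝ, ModelE n →L[ℝ] ModelE n)) ∞
    (fun x ↦ TotalSpace.mk' (ModelE n →L[ℝ] ModelE n)
      (E := fun x : M ↦ Tan n x →L[ℝ] Tan n x) x (J x))

/-- Cartan's expression `X(λ(Y)) - Y(λ(X)) - λ([X,Y])` at the point `x`. -/
def cartanExpr (lam : Π x : M, Tan n x →L[ℝ] ℝ) (X Y : Π x : M, Tan n x) (x : M) : ℝ :=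
  mvfderiv (𝓡 (2 * n + 1)) (fun y ↦ lam y (Y y)) x (X x)
    - mvfderiv (𝓡 (2 * n + 1)) (fun y ↦ lam y (X y)) x (Y x)
    - lam x (mlieBracket (𝓡 (2 * n + 1)) X Y x)

theorem SmoothOneForm.mdifferentiableAt_apply {lam : Π x : M, Tan n x →L[ℝ] ℝ}
    (h : SmoothOneForm lam) {X : Π x : M, Tan n x} {x : M} (hX : DiffAt X x) :
    MDifferentiableAt (𝓡 (2 * n + 1)) 𝓘(ℝ) (fun y ↦ lam y (X y)) x := by
  have : MDifferentiableAt (𝓡 (2 * n + 1)) ((𝓡 (2 * n + 1)).prod 𝓘(ℝ))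
      (fun m ↦ TotalSpace.mk' ℝ (E := Bundle.Trivial M ℝ) m (lam m (X m))) x := by
    apply MDifferentiableAt.clm_bundle_apply (F₁ := ModelE n)
    · exact h.mdifferentiableAt (by simp)
    · exact hX
  simp only [mdifferentiableAt_totalSpace] at this
  exact this.2

theorem cartanExpr_swap (lam : Π x : M, Tan n x →L[ℝ] ℝ) (X Y : Π x : M, Tan n x) (x : M) :
    cartanExpr lam X Y x = - cartanExpr lam Y X x := by
  unfold cartanExpr
  rw [mlieBracket_swap]
  simp
  ring

theorem tensorialAt_cartanExpr {lam : Π x : M, Tan n x →L[ℝ] ℝ} (h : SmoothOneForm lam)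
    (x : M) (X : Π x : M, Tan n x) :
    TensorialAt (𝓡 (2 * n + 1)) (ModelE n) (fun Y ↦ cartanExpr lam X Y x) x where
  smul {f Y} hf hY := by
    have h1 : (fun y ↦ lam y ((f • Y) y)) = fun y ↦ f y * lam y (Y y) := by
      ext y; simp
    have h3 : ((f • Y) x) = f x • Y x := rfl
    unfold cartanExpr
    rw [h1, h3, mlieBracket_smul_right hf hY, mvfderiv_fun_mul hf (h.mdifferentiableAt_apply hY)]
    simp only [map_add, map_smul, smul_eq_mul, add_apply, smul_apply]
    ring
  add {Y Y'} hY hY' := by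
    have h1 : (fun y ↦ lam y ((Y + Y') y)) = fun y ↦ lam y (Y y) + lam y (Y' y) := by
      ext y; simp
    have h3 : ((Y + Y') x) = Y x + Y' x := rfl
    unfold cartanExpr
    rw [h1, h3, mlieBracket_add_right hY hY',
      mvfderiv_fun_add (h.mdifferentiableAt_apply hY) (h.mdifferentiableAt_apply hY')]
    simp only [map_add, add_apply]
    ring

theorem tensorialAt_cartanExpr' {lam : Π x : M, Tan n x →L[ℝ] ℝ} (h : SmoothOneForm lam)
    (x : M) (Y : Π x : M, Tan n x) :
    TensorialAt (𝓡 (2 * n + 1)) (ModelE n) (fun X ↦ cartanExpr lam X Y x) x where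
  smul {f X} hf hX := by
    have := (tensorialAt_cartanExpr h x Y).smul hf hX
    simp only [cartanExpr_swap lam _ Y, this]
    simp
  add {X X'} hX hX' := by
    have := (tensorialAt_cartanExpr h x Y).add hX hX'
    simp only [cartanExpr_swap lam _ Y, this]
    ring

/-- The exterior derivative of a smooth one-form, with the convention
`dλ(X,Y) = X(λ(Y)) - Y(λ(X)) - λ([X,Y])` (no factor `1/2`). -/
def extDerivOneForm {lam : Π x : M, Tan n x →L[ℝ] ℝ} (h : SmoothOneForm lam) (x : M) :
    Tan n x →L[ℝ] Tan n x →L[ℝ] ℝ :=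
  TensorialAt.mkHom₂ (fun X Y ↦ cartanExpr lam X Y x) x
    (fun Y _ ↦ tensorialAt_cartanExpr' h x Y) (fun X _ ↦ tensorialAt_cartanExpr h x X)

theorem extDerivOneForm_apply {lam : Π x : M, Tan n x →L[ℝ] ℝ} (h : SmoothOneForm lam) {x : M}
    {X Y : Π x : M, Tan n x} (hX : DiffAt X x) (hY : DiffAt Y x) :
    extDerivOneForm h x (X x) (Y x) = cartanExpr lam X Y x :=
  TensorialAt.mkHom₂_apply _ _ hX hY


/-- The value on `(v_0, …, v_{2n})` of `λ ∧ (dλ)^n` at a point, for a covector `a` and a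
bilinear form `b` standing for `λ` and `dλ` (up to the positive factor `2^n`). -/
def wedgeTop {V : Type*} (a : V → ℝ) (b : V → V → ℝ) (v : Fin (2 * n + 1) → V) : ℝ :=
  ∑ s : Equiv.Perm (Fin (2 * n + 1)), ((Equiv.Perm.sign s : ℤ) : ℝ) *
    (a (v (s ⟨0, by omega⟩)) *
      ∏ i : Fin n, b (v (s ⟨2 * (i : ℕ) + 1, by omega⟩)) (v (s ⟨2 * (i : ℕ) + 2, by omega⟩)))

/-- The contact condition: `λ ∧ (dλ)^n` vanishes nowhere. -/
def IsContactForm {lam : Π x : M, Tan n x →L[ℝ] ℝ} (h : SmoothOneForm lam) : Prop :=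
  ∀ x : M, ∃ v : Fin (2 * n + 1) → Tan n x,
    wedgeTop (fun u ↦ lam x u) (fun u w ↦ extDerivOneForm h x u w) v ≠ 0

open Classical in
/-- The Reeb vector field: `λ(R) = 1` and `dλ(R, ·) = 0`.  For a contact form these two
conditions have exactly one solution at every point. -/
def reebField {lam : Π x : M, Tan n x →L[ℝ] ℝ} (h : SmoothOneForm lam) (x : M) : Tan n x :=
  if hv : ∃ v : Tan n x, lam x v = 1 ∧ ∀ w, extDerivOneForm h x v w = 0 then hv.choose else 0

end

/-- A contact triad `(M, λ, J)`.  The complex structure on `ξ = ker λ` is extended to `TM` by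
`J(R) = 0`. -/
structure ContactTriad (n : ℕ) (M : Type*) [TopologicalSpace M] [ChartedSpace (ModelE n) M]
    [IsManifold (𝓡 (2 * n + 1)) ∞ M] where
  /-- the contact form `λ` -/
  lam : Π x : M, Tan n x →L[ℝ] ℝ
  smooth_lam : SmoothOneForm lam
  contact : IsContactForm smooth_lam
  /-- the endomorphism `J` -/
  J : Π x : M, Tan n x →L[ℝ] Tan n x
  smooth_J : SmoothEndo J
  J_reeb : ∀ x, J x (reebField smooth_lam x) = 0
  J_mem : ∀ x v, lam x v = 0 → lam x (J x v) = 0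
  J_sq : ∀ x v, lam x v = 0 → J x (J x v) = -v
  /-- `dλ(·, J ·)` is symmetric on `ξ` … -/
  symm : ∀ x v w, lam x v = 0 → lam x w = 0 →
    extDerivOneForm smooth_lam x v (J x w) = extDerivOneForm smooth_lam x w (J x v)
  /-- … and positive definite. -/
  pos : ∀ x v, lam x v = 0 → v ≠ 0 → 0 < extDerivOneForm smooth_lam x v (J x v)

/-- Affine connections, i.e. covariant derivatives on `TM`.  In `D X x v` the field `X` is
differentiated at `x` in the direction `v`, i.e. `D X x v = ∇_v X`. -/
abbrev AffineConnection (n : ℕ) (M : Type*) [TopologicalSpace M] [ChartedSpace (ModelE n) M]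
    [IsManifold (𝓡 (2 * n + 1)) ∞ M] :=
  CovariantDerivative (𝓡 (2 * n + 1)) (ModelE n) (TangentSpace (𝓡 (2 * n + 1)) : M → Type _)

/-- The complexified tangent space. -/
abbrev TanC (n : ℕ) {M : Type*} [TopologicalSpace M] [ChartedSpace (ModelE n) M] (x : M) : Type :=
  ℂ ⊗[ℝ] Tan n x

/-- Complex-linear extension to `V ⊗ ℂ` of a real linear form on `V`. -/
def extC {V : Type*} [AddCommGroup V] [Module ℝ V] (a : V →ₗ[ℝ] ℝ) : ℂ ⊗[ℝ] V →ₗ[ℂ] ℂ :=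
  LinearMap.liftBaseChange ℂ ((Algebra.linearMap ℝ ℂ).comp a)

/-- The wedge product of two one-forms: `(a ∧ b)(Z, W) = a(Z) b(W) - a(W) b(Z)`. -/
def wedge {V : Type*} [AddCommGroup V] [Module ℂ V] (a b : V →ₗ[ℂ] ℂ) (Z W : V) : ℂ :=
  a Z * b W - a W * b Z

section

variable {n : ℕ} {M : Type*} [TopologicalSpace M] [ChartedSpace (ModelE n) M]
  [IsManifold (𝓡 (2 * n + 1)) ∞ M]

/-- A smooth affine connection: it maps smooth fields to smooth fields. -/
def AffineConnection.IsSmooth (D : AffineConnection n M) : Prop :=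
  CovariantDerivative.ContMDiffCovariantDerivative D ∞

/-- Equality of connections: a covariant derivative in Mathlib is a function on all (also
non-differentiable) fields, and only its values on differentiable fields are meaningful. -/
def AffineConnection.Agrees (D D' : AffineConnection n M) : Prop :=
  ∀ (X : Π x : M, Tan n x) (x : M), DiffAt X x → D X x = D' X x

namespace ContactTriad

variable (T : ContactTriad n M)

/-- The Reeb vector field `R`. -/
def reeb (x : M) : Tan n x := reebField T.smooth_lam x

/-- The two-form `dλ`. -/
def dlam (x : M) : Tan n x →L[ℝ] Tan n x →L[ℝ] ℝ := extDerivOneForm T.smooth_lam x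

/-- The triad metric `g = dλ(·, J ·) + λ ⊗ λ`. -/
def g (x : M) : Tan n x →ₗ[ℝ] Tan n x →ₗ[ℝ] ℝ :=
  LinearMap.mk₂ ℝ (fun v w ↦ T.dlam x v (T.J x w) + T.lam x v * T.lam x w)
    (by intros; simp; ring) (by intros; simp; ring) (by intros; simp; ring) (by intros; simp; ring)

/-- The projection `π : TM → ξ` along `R`. -/
def proj (x : M) (v : Tan n x) : Tan n x := v - T.lam x v • T.reeb x

/-! ### Conditions on an affine connection -/

/-- `∇g = 0`. -/
def IsRiemannian (D : AffineConnection n M) : Prop :=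
  ∀ (Y Z : Π x : M, Tan n x) (x : M) (v : Tan n x), DiffAt Y x → DiffAt Z x →
    mvfderiv (𝓡 (2 * n + 1)) (fun y ↦ T.g y (Y y) (Z y)) x v
      = T.g x (D Y x v) (Z x) + T.g x (Y x) (D Z x v)

/-- `∇^π = π ∇|_ξ` is a Hermitian connection of `ξ`: it preserves `g|_ξ` and `J`. -/
def IsHermitianOnXi (D : AffineConnection n M) : Prop :=
  ∀ (Y Z : Π x : M, Tan n x) (x : M) (v : Tan n x),
    (∀ y, T.lam y (Y y) = 0) → (∀ y, T.lam y (Z y) = 0) → DiffAt Y x → DiffAt Z x →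
    (mvfderiv (𝓡 (2 * n + 1)) (fun y ↦ T.g y (Y y) (Z y)) x v
        = T.g x (T.proj x (D Y x v)) (Z x) + T.g x (Y x) (T.proj x (D Z x v))) ∧
      T.proj x (D (fun y ↦ T.J y (Y y)) x v) = T.J x (T.proj x (D Y x v))

/-- The torsion vanishes whenever one argument is the Reeb field. -/
def IsReebTorsionFree (D : AffineConnection n M) : Prop :=
  ∀ (x : M) (v : Tan n x), D.torsion x (T.reeb x) v = 0

/-- The `c`-contact triad connections; `c = 0` gives the contact triad connections. -/
structure IsContactTriadConnection (c : ℝ) (D : AffineConnection n M) : Prop where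
  riemannian : T.IsRiemannian D
  reeb_reeb : ∀ x, D T.reeb x (T.reeb x) = 0
  xi_reeb : ∀ x v, T.lam x v = 0 → T.lam x (D T.reeb x v) = 0
  cauchyRiemann : ∀ x v, T.lam x v = 0 → D T.reeb x (T.J x v) + T.J x (D T.reeb x v) = c • v
  reeb_torsion : T.IsReebTorsionFree D
  hermitian : T.IsHermitianOnXi D
  torsion_xi : ∀ x v, T.lam x v = 0 → T.proj x (D.torsion x (T.J x v) v) = 0

/-- The conditions imposed before any condition on the complex torsion. -/
structure IsAdapted (D : AffineConnection n M) : Prop where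
  riemannian : T.IsRiemannian D
  hermitian : T.IsHermitianOnXi D
  reeb_torsion : T.IsReebTorsionFree D

/-! ### Complexification -/

/-- Complex-linear extension of `J`. -/
def JC (x : M) : TanC n x →ₗ[ℂ] TanC n x := (T.J x : Tan n x →ₗ[ℝ] Tan n x).baseChange ℂ

/-- Complex-linear extension of `λ`. -/
def lamC (x : M) : TanC n x →ₗ[ℂ] ℂ := extC (T.lam x : Tan n x →ₗ[ℝ] ℝ)

/-- Complex-bilinear extension of `dλ`. -/
def dlamC (x : M) : TanC n x →ₗ[ℂ] TanC n x →ₗ[ℂ] ℂ :=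
  LinearMap.BilinForm.baseChange ℂ (T.dlam x).toLinearMap₁₂

/-- `R` as a vector of `TM ⊗ ℂ`. -/
def reebC (x : M) : TanC n x := (1 : ℂ) ⊗ₜ[ℝ] T.reeb x

/-- `ξ^{(1,0)}`, the `√-1`-eigenspace of `J`. -/
def xi10 (x : M) : Set (TanC n x) := {Z | T.JC x Z = Complex.I • Z}

/-- `ξ^{(0,1)}`, the `-√-1`-eigenspace of `J`. -/
def xi01 (x : M) : Set (TanC n x) := {Z | T.JC x Z = -(Complex.I • Z)}

/-- The horizontal part `a^π = a - a(R) λ` of a complex one-form. -/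
def horizontal (x : M) (a : TanC n x →ₗ[ℂ] ℂ) : TanC n x →ₗ[ℂ] ℂ :=
  a - a (T.reebC x) • T.lamC x

/-- The `(1,1)` component of (the restriction to `ξ ⊗ ℂ` of) a complex two-form vanishes. -/
def Vanishes11 (x : M) (b : TanC n x → TanC n x → ℂ) : Prop :=
  ∀ Z ∈ T.xi10 x, ∀ W ∈ T.xi01 x, b Z W = 0

/-- The `(2,0)` component of (the restriction to `ξ ⊗ ℂ` of) a complex two-form vanishes. -/
def Vanishes20 (x : M) (b : TanC n x → TanC n x → ℂ) : Prop :=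
  ∀ Z ∈ T.xi10 x, ∀ W ∈ T.xi10 x, b Z W = 0

/-- A horizontal complex one-form is of type `(0,1)`. -/
def IsType01 (x : M) (a : TanC n x →ₗ[ℂ] ℂ) : Prop := ∀ Z ∈ T.xi10 x, a Z = 0

/-- A smooth Darboux frame `E_1, …, E_n, F_1, …, F_n, R` (`F_i = J E_i`) over the open set `U`,
orthonormal for the triad metric; the associated almost contact frame is
`η_i = (E_i - √-1 F_i)/√2`, `η̄_i`, `R`. -/
structure Frame where
  U : Set M
  isOpen : IsOpen U
  E : Fin n → Π x : M, Tan n x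
  smooth : ∀ i, SmoothOnSet (E i) U
  horizontal : ∀ i, ∀ x ∈ U, T.lam x (E i x) = 0
  orthonormal : ∀ i j, ∀ x ∈ U, T.g x (E i x) (E j x) = if i = j then 1 else 0
  orthogonal : ∀ i j, ∀ x ∈ U, T.g x (E i x) (T.J x (E j x)) = 0

namespace Frame

variable {T} (B : T.Frame)

/-- `F_i = J E_i`. -/
def F (i : Fin n) (x : M) : Tan n x := T.J x (B.E i x)

/-- The dual one-form `θ^i = (e^i + √-1 f^i)/√2`, with `e^i = g(E_i, ·)`, `f^i = g(F_i, ·)`. -/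
def theta (i : Fin n) (x : M) : TanC n x →ₗ[ℂ] ℂ :=
  (1 / (Real.sqrt 2 : ℂ)) • (extC (T.g x (B.E i x)) + Complex.I • extC (T.g x (B.F i x)))

/-- The dual one-form `θ̄^i = (e^i - √-1 f^i)/√2`. -/
def thetaBar (i : Fin n) (x : M) : TanC n x →ₗ[ℂ] ℂ :=
  (1 / (Real.sqrt 2 : ℂ)) • (extC (T.g x (B.E i x)) - Complex.I • extC (T.g x (B.F i x)))

end Frame

/-- For a real field `X`, the complex-linear map `Z ↦ ∇_Z X`. -/
def _root_.AffineConnection.covC (D : AffineConnection n M) (X : Π x : M, Tan n x) (x : M) :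
    TanC n x →ₗ[ℂ] TanC n x :=
  (D X x : Tan n x →ₗ[ℝ] Tan n x).baseChange ℂ

/-- Complex-bilinear extension of the torsion. -/
def _root_.AffineConnection.torsionC (D : AffineConnection n M) (x : M) :
    TanC n x →ₗ[ℂ] TanC n x →ₗ[ℂ] TanC n x :=
  LinearMap.BilinMap.baseChange ℂ (D.torsion x).toLinearMap₁₂

/-- `Θ^0 = λ(T_ℂ)`. -/
def Theta0 (D : AffineConnection n M) (x : M) (Z W : TanC n x) : ℂ :=
  T.lamC x (D.torsionC x Z W)

namespace Frame

variable {T} (B : T.Frame)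

/-- `Z ↦ ∇_Z η_k`, with `∇` extended complex-linearly. -/
def covEta (D : AffineConnection n M) (k : Fin n) (x : M) : TanC n x →ₗ[ℂ] TanC n x :=
  (1 / (Real.sqrt 2 : ℂ)) • (D.covC (B.E k) x - Complex.I • D.covC (B.F k) x)

/-- `Z ↦ ∇_Z η̄_k`, with `∇` extended complex-linearly. -/
def covEtaBar (D : AffineConnection n M) (k : Fin n) (x : M) : TanC n x →ₗ[ℂ] TanC n x :=
  (1 / (Real.sqrt 2 : ℂ)) • (D.covC (B.E k) x + Complex.I • D.covC (B.F k) x)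

/-- `α_k`: the coefficient of `η_k` in `∇R = ∑ α_k η_k + ∑ ᾱ_k η̄_k + λ(∇R) R`. -/
def alpha (D : AffineConnection n M) (k : Fin n) (x : M) : TanC n x →ₗ[ℂ] ℂ :=
  (B.theta k x).comp (D.covC T.reeb x)

/-- `a_k`: the coefficient of `R` in `∇η_k`. -/
def reebCoeff (D : AffineConnection n M) (k : Fin n) (x : M) : TanC n x →ₗ[ℂ] ℂ :=
  (T.lamC x).comp (B.covEta D k x)

/-- `ā_k`: the coefficient of `R` in `∇η̄_k`. -/
def reebCoeffBar (D : AffineConnection n M) (k : Fin n) (x : M) : TanC n x →ₗ[ℂ] ℂ :=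
  (T.lamC x).comp (B.covEtaBar D k x)

/-- `Θ^i = θ^i(T_ℂ)`. -/
def Theta (D : AffineConnection n M) (i : Fin n) (x : M) (Z W : TanC n x) : ℂ :=
  B.theta i x (D.torsionC x Z W)

/-- The complex characterization in the frame, for general `c`:
`Θ^0 = dλ + ∑ (a_k ∧ θ^k + ā_k ∧ θ̄^k)`, `Θ^{π(1,1)} = 0` and `J · α_k = -√-1 α_k^π + c θ^k`,
where `(J · α)(Z) = α(JZ)`. -/
structure TorsionConditions (c : ℝ) (D : AffineConnection n M) : Prop where
  reeb_part : ∀ x ∈ B.U, ∀ Z W : TanC n x, T.Theta0 D x Z W = T.dlamC x Z W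
    + ∑ k, (wedge (B.reebCoeff D k x) (B.theta k x) Z W
      + wedge (B.reebCoeffBar D k x) (B.thetaBar k x) Z W)
  xi_part : ∀ x ∈ B.U, ∀ i, T.Vanishes11 x (B.Theta D i x)
  alpha_part : ∀ x ∈ B.U, ∀ k, ∀ Z : TanC n x, B.alpha D k x (T.JC x Z)
    = -Complex.I * T.horizontal x (B.alpha D k x) Z + (c : ℂ) * B.theta k x Z

/-- The complex characterization in the frame for `c = 0`:
`Θ^0 = dλ + ∑ a_k ∧ θ^k`, `Θ^{π(1,1)} = 0` and `α_k^π` is of type `(0,1)`. -/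
structure TorsionConditionsZero (D : AffineConnection n M) : Prop where
  reeb_part : ∀ x ∈ B.U, ∀ Z W : TanC n x, T.Theta0 D x Z W = T.dlamC x Z W
    + ∑ k, wedge (B.reebCoeff D k x) (B.theta k x) Z W
  xi_part : ∀ x ∈ B.U, ∀ i, T.Vanishes11 x (B.Theta D i x)
  alpha_part : ∀ x ∈ B.U, ∀ k, T.IsType01 x (T.horizontal x (B.alpha D k x))

end Frame

end ContactTriad

end

end

open scoped Topology

noncomputable section

/-! ### Vector fields, derivatives and brackets on a manifold. -/

section Calculus

/-! For an adapted connection put `A = ∇R`. All conditions reduce to two real equations on `ξ` at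
each point: `AJ + JA = c` and `πT(JY, Y) = 0`. The formula for `Θ^0` holds for every metric
connection, since `λ(∇η_k)` is determined by `A` (`Frame.Theta0_eq`). The form `θ^k` turns `J` into
`√-1`, so the condition on `α_k` is the first equation (`Frame.alpha_iff`), and splitting into types
turns `Θ^{π(1,1)} = 0` into the second (`Frame.vanishes11_Theta_iff`). The conditions `λ(∇R) = 0`
and `∇_R R = 0` follow from adaptedness. This gives part 2.

Existence. The flat connections that make local unitary frames parallel are glued by a partition of
unity to a connection for which `g`, `J` and `R` are parallel. Let `τ` be its torsion, `t = τ(R,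
·)`, and let `Q` be minus the component of `πτ` on `ξ` that is antilinear in the first slot and
linear in the second. One adds `S_v w = Q_v w - Q_v^T w - g(Av, w) R + λ(w) Av + λ(v)(Aw - tw)`,
where `A = -(c/2) J + (t + JtJ)/2`. Since `d(dλ) = 0`, `JtJ` is the transpose of `t`; hence `A - t`
is skew and every `S_v` is skew. The `Q` terms remove the `(1,1)` torsion, and the other terms give
the prescribed `∇R` and `T(R, ·) = 0`.

Uniqueness. Let `S` be the difference of two solutions. `S_R` equals the difference of the two `∇R`;
it commutes with `J` by the Hermitian condition and anticommutes with it by the first equation, so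
it vanishes. On `ξ`, equality of the `(1,1)` torsions forces `S_{Jv} = J S_v`. Then `J S_v` is skew,
being `S_{Jv}`, and symmetric, being a product of commuting skew maps, so it is zero.

Part 3. By `d(dλ) = 0`, the cyclic sum of `dλ(T(u, v), w)` vanishes on `ξ`. For `u, v` of type
`(1,0)` and `w` of type `(0,1)` two of the terms are `(1,1)` torsion, so the third vanishes too.
Part 4: for `c = 0`, both `A` and `JA` are `g`-symmetric, which kills `∑ ā_k ∧ θ̄^k`. -/

theorem two_le_infty : (2 : WithTop ℕ∞) ≤ ∞ := WithTop.coe_le_coe.2 (le_top : (2 : ℕ∞) ≤ ⊤)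

theorem three_le_infty : (3 : WithTop ℕ∞) ≤ ∞ := WithTop.coe_le_coe.2 (le_top : (3 : ℕ∞) ≤ ⊤)

variable {n : ℕ} {M : Type*} [TopologicalSpace M] [ChartedSpace (ModelE n) M]

/-- A function is smooth at a point, to all finite orders. -/
abbrev SmoothFnAt (n : ℕ) {M : Type*} [TopologicalSpace M] [ChartedSpace (ModelE n) M]
    (f : M → ℝ) (x : M) : Prop :=
  ContMDiffAt (𝓡 (2 * n + 1)) 𝓘(ℝ) ∞ f x

/-- A function is differentiable at a point. -/
abbrev DiffFnAt (n : ℕ) {M : Type*} [TopologicalSpace M] [ChartedSpace (ModelE n) M]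
    (f : M → ℝ) (x : M) : Prop :=
  MDifferentiableAt (𝓡 (2 * n + 1)) 𝓘(ℝ) f x

/-- The derivative of the function `f` at `x`, as a covector. -/
abbrev dfn (n : ℕ) {M : Type*} [TopologicalSpace M] [ChartedSpace (ModelE n) M]
    (f : M → ℝ) (x : M) : Tan n x →L[ℝ] ℝ :=
  mvfderiv (𝓡 (2 * n + 1)) f x

variable [IsManifold (𝓡 (2 * n + 1)) ∞ M]

/-- A vector field is smooth at a point, to all finite orders. -/
def SmoothAt (X : Π x : M, Tan n x) (x : M) : Prop :=
  ContMDiffAt (𝓡 (2 * n + 1)) ((𝓡 (2 * n + 1)).prod 𝓘(ℝ, ModelE n)) ∞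
    (fun y ↦ TotalSpace.mk' (ModelE n) (E := (TangentSpace (𝓡 (2 * n + 1)) : M → Type _)) y (X y)) x

theorem SmoothAt.diffAt {X : Π x : M, Tan n x} {x : M} (h : SmoothAt X x) : DiffAt X x :=
  ContMDiffAt.mdifferentiableAt h (by simp)

omit [IsManifold (𝓡 (2 * n + 1)) ∞ M] in
theorem smoothFnAt_diff {f : M → ℝ} {x : M} (h : SmoothFnAt n f x) : DiffFnAt n f x :=
  ContMDiffAt.mdifferentiableAt h (by simp)

/-- Smoothness of order `∞` at a point need not spread to a neighbourhood, but each finite order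
does; order 1 is enough to use pointwise formulas near the point. -/
theorem SmoothAt.eventually_diffAt {X : Π x : M, Tan n x} {x : M} (h : SmoothAt X x) :
    ∀ᶠ y in 𝓝 x, DiffAt X y := by
  have h1 : ContMDiffAt (𝓡 (2 * n + 1)) ((𝓡 (2 * n + 1)).prod 𝓘(ℝ, ModelE n)) 1
    (fun y ↦ TotalSpace.mk' (ModelE n) (E := (TangentSpace (𝓡 (2 * n + 1)) : M → Type _)) y (X y))
      x := ContMDiffAt.of_le h (by simp)
  have : IsManifold (𝓡 (2 * n + 1)) 1 M := IsManifold.of_le (n := ∞) (by simp)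
  filter_upwards [(contMDiffAt_iff_contMDiffAt_nhds (by simp)).1 h1] with y hy
  exact ContMDiffAt.mdifferentiableAt hy one_ne_zero

theorem smoothFnAt_eventually_diff {f : M → ℝ} {x : M} (h : SmoothFnAt n f x) :
    ∀ᶠ y in 𝓝 x, DiffFnAt n f y := by
  have h1 : ContMDiffAt (𝓡 (2 * n + 1)) 𝓘(ℝ) 1 f x := ContMDiffAt.of_le h (by simp)
  have : IsManifold (𝓡 (2 * n + 1)) 1 M := IsManifold.of_le (n := ∞) (by simp)
  filter_upwards [(contMDiffAt_iff_contMDiffAt_nhds (by simp)).1 h1] with y hy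
  exact ContMDiffAt.mdifferentiableAt hy one_ne_zero

theorem SmoothOnSet.smoothAt {X : Π x : M, Tan n x} {U : Set M} (h : SmoothOnSet X U)
    (hU : IsOpen U) {x : M} (hx : x ∈ U) : SmoothAt X x :=
  ContMDiffOn.contMDiffAt h (hU.mem_nhds hx)

theorem smoothOnSet_of_forall {X : Π x : M, Tan n x} {U : Set M} (h : ∀ x ∈ U, SmoothAt X x) :
    SmoothOnSet X U :=
  fun x hx ↦ (h x hx).contMDiffWithinAt

theorem SmoothAt.congr {X Y : Π x : M, Tan n x} {x : M} (h : SmoothAt X x)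
    (hXY : ∀ᶠ y in 𝓝 x, Y y = X y) : SmoothAt Y x := by
  refine ContMDiffAt.congr_of_eventuallyEq h ?_
  filter_upwards [hXY] with y hy
  simp [hy]

theorem SmoothAt.add {X Y : Π x : M, Tan n x} {x : M} (hX : SmoothAt X x) (hY : SmoothAt Y x) :
    SmoothAt (fun y ↦ X y + Y y) x := ContMDiffAt.add_section hX hY

theorem SmoothAt.sub {X Y : Π x : M, Tan n x} {x : M} (hX : SmoothAt X x) (hY : SmoothAt Y x) :
    SmoothAt (fun y ↦ X y - Y y) x := ContMDiffAt.sub_section hX hY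

theorem SmoothAt.smul {f : M → ℝ} {X : Π x : M, Tan n x} {x : M} (hf : SmoothFnAt n f x)
    (hX : SmoothAt X x) : SmoothAt (fun y ↦ f y • X y) x := ContMDiffAt.smul_section hf hX

theorem SmoothAt.const_smul (a : ℝ) {X : Π x : M, Tan n x} {x : M}
    (hX : SmoothAt X x) : SmoothAt (fun y ↦ a • X y) x := ContMDiffAt.const_smul_section hX

theorem SmoothAt.sum {ι : Type*} {s : Finset ι} {X : ι → Π x : M, Tan n x} {x : M}
    (hX : ∀ i ∈ s, SmoothAt (X i) x) : SmoothAt (fun y ↦ ∑ i ∈ s, X i y) x :=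
  ContMDiffAt.sum_section hX

theorem SmoothAt.zero (x : M) : SmoothAt (fun y : M ↦ (0 : Tan n y)) x :=
  (contMDiff_zeroSection ℝ (TangentSpace (𝓡 (2 * n + 1)) : M → Type _)).contMDiffAt

theorem SmoothAt.bracket {X Y : Π x : M, Tan n x} {x : M} (hX : SmoothAt X x)
    (hY : SmoothAt Y x) : SmoothAt (mlieBracket (𝓡 (2 * n + 1)) X Y) x := by
  have : IsManifold (𝓡 (2 * n + 1)) ((⊤ : ℕ∞) + 1) M := by simpa using ‹_›
  have : IsManifold (𝓡 (2 * n + 1)) (minSmoothness ℝ 2) M :=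
    IsManifold.of_le (n := ∞) (by simpa using two_le_infty)
  exact ContMDiffAt.mlieBracket_vectorField (n := ⊤) (m := ⊤) hX hY (by simp)

/-- Every tangent vector extends to a vector field that is smooth at the base point. -/
theorem exists_smoothAt_extend {x : M} (v : Tan n x) :
    ∃ X : Π x : M, Tan n x, SmoothAt X x ∧ X x = v :=
  ⟨extend (ModelE n) v, contMDiffAt_extend (𝓡 (2 * n + 1)) (ModelE n) v, extend_apply_self (ModelE n) v⟩

omit [IsManifold (𝓡 (2 * n + 1)) ∞ M] in
theorem dfn_congr {f g : M → ℝ} {x : M} (h : ∀ᶠ y in 𝓝 x, f y = g y) :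
    dfn n f x = dfn n g x := by
  have h' : f =ᶠ[𝓝 x] g := h
  simp only [mvfderiv]
  rw [h'.mfderiv_eq]
  rfl

/-- The derivative of a smooth function along a smooth field is smooth. -/
theorem SmoothAt.dfn {f : M → ℝ} {X : Π x : M, Tan n x} {x : M} (hf : SmoothFnAt n f x)
    (hX : SmoothAt X x) : SmoothFnAt n (fun y ↦ dfn n f y (X y)) x := by
  have h1 := ContMDiffAt.mfderiv_const (m := ∞) hf (by simp)
  have h2 := ContMDiffAt.clm_apply_of_inCoordinates (b₁ := id) (b₂ := f)
    (E₁ := (TangentSpace (𝓡 (2 * n + 1)) : M → Type _)) (E₂ := (TangentSpace 𝓘(ℝ) : ℝ → Type _))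
    (v := X) (ϕ := mfderiv (𝓡 (2 * n + 1)) 𝓘(ℝ) f) h1 hX hf
  rw [contMDiffAt_totalSpace] at h2
  simpa using! h2.2

omit [IsManifold (𝓡 (2 * n + 1)) ∞ M] in
theorem dfn_const (a : ℝ) (x : M) : dfn n (fun _ : M ↦ a) x = 0 := mvfderiv_const a

omit [IsManifold (𝓡 (2 * n + 1)) ∞ M] in
theorem dfn_mul {f g : M → ℝ} {x : M} (hf : DiffFnAt n f x) (hg : DiffFnAt n g x) (v : Tan n x) :
    dfn n (fun y ↦ f y * g y) x v = f x * dfn n g x v + g x * dfn n f x v := by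
  simp [dfn, mvfderiv_fun_mul hf hg]

omit [IsManifold (𝓡 (2 * n + 1)) ∞ M] in
theorem dfn_add {f g : M → ℝ} {x : M} (hf : DiffFnAt n f x) (hg : DiffFnAt n g x) (v : Tan n x) :
    dfn n (fun y ↦ f y + g y) x v = dfn n f x v + dfn n g x v := by
  simp [dfn, mvfderiv_fun_add hf hg]

omit [IsManifold (𝓡 (2 * n + 1)) ∞ M] in
theorem dfn_sub {f g : M → ℝ} {x : M} (hf : DiffFnAt n f x) (hg : DiffFnAt n g x) (v : Tan n x) :
    dfn n (fun y ↦ f y - g y) x v = dfn n f x v - dfn n g x v := by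
  simp [dfn, mvfderiv_fun_sub hf hg]

omit [IsManifold (𝓡 (2 * n + 1)) ∞ M] in
theorem dfn_neg {f : M → ℝ} {x : M} (v : Tan n x) :
    dfn n (fun y ↦ -f y) x v = -dfn n f x v := by
  simp [dfn, mvfderiv_fun_neg]

omit [IsManifold (𝓡 (2 * n + 1)) ∞ M] in
theorem diffFnAt_sum {ι : Type*} {s : Finset ι} {f : ι → M → ℝ} {x : M}
    (hf : ∀ i ∈ s, DiffFnAt n (f i) x) : DiffFnAt n (fun y ↦ ∑ i ∈ s, f i y) x := by
  classical
  induction s using Finset.induction_on with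
  | empty => simpa using mdifferentiableAt_const
  | insert i s his ih =>
    simp only [Finset.sum_insert his]
    exact (hf i (by simp)).add (ih fun j hj ↦ hf j (by simp [hj]))

omit [IsManifold (𝓡 (2 * n + 1)) ∞ M] in
theorem dfn_sum {ι : Type*} {s : Finset ι} {f : ι → M → ℝ} {x : M}
    (hf : ∀ i ∈ s, DiffFnAt n (f i) x) (v : Tan n x) :
    dfn n (fun y ↦ ∑ i ∈ s, f i y) x v = ∑ i ∈ s, dfn n (f i) x v := by
  classical
  induction s using Finset.induction_on with
  | empty => simp [dfn_const]
  | insert i s his ih =>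
    simp only [Finset.sum_insert his]
    rw [dfn_add (hf i (by simp)) (diffFnAt_sum fun j hj ↦ hf j (by simp [hj])),
      ih fun j hj ↦ hf j (by simp [hj])]

/-- The Lie bracket acts on functions as the commutator of derivations. -/
theorem dfn_bracket {f : M → ℝ} {X Y : Π x : M, Tan n x} {x : M} (hf : SmoothFnAt n f x)
    (hX : SmoothAt X x) (hY : SmoothAt Y x) :
    dfn n f x (mlieBracket (𝓡 (2 * n + 1)) X Y x) =
      dfn n (fun y ↦ dfn n f y (Y y)) x (X x) - dfn n (fun y ↦ dfn n f y (X y)) x (Y x) := by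
  have : IsManifold (𝓡 (2 * n + 1)) (minSmoothness ℝ 3) M :=
    IsManifold.of_le (n := ∞) (by simpa using three_le_infty)
  have : IsManifold (𝓡 (2 * n + 1)) (minSmoothness ℝ 2) M :=
    IsManifold.of_le (n := ∞) (by simpa using two_le_infty)
  have : Nontrivial (Tan n x) := inferInstanceAs (Nontrivial (EuclideanSpace ℝ (Fin (2 * n + 1))))
  -- The commutator identity is extracted from the Jacobi identity for `X`, `Y` and `fZ`: after
  -- expanding by the Leibniz rule and subtracting `f` times the Jacobi identity for `Z`, only
  -- multiples of `Z` remain, and `Z` is nonzero at `x`.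
  obtain ⟨z, hz⟩ := exists_ne (0 : Tan n x)
  obtain ⟨Z, hZ, rfl⟩ := exists_smoothAt_extend z
  have key : ∀ {W : Π x : M, Tan n x}, SmoothAt W x →
      mlieBracket (𝓡 (2 * n + 1)) W (f • Z) =ᶠ[𝓝 x]
        ((fun y ↦ dfn n f y (W y)) • Z + f • mlieBracket (𝓡 (2 * n + 1)) W Z) := by
    intro W hW
    filter_upwards [hZ.eventually_diffAt, smoothFnAt_eventually_diff hf] with y h1 h2
    simp only [Pi.add_apply, Pi.smul_apply']
    rw [mlieBracket_smul_right h2 h1]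
  have expand : ∀ {V W : Π x : M, Tan n x}, SmoothAt V x → SmoothAt W x →
      mlieBracket (𝓡 (2 * n + 1)) V (mlieBracket (𝓡 (2 * n + 1)) W (f • Z)) x =
        dfn n (fun y ↦ dfn n f y (W y)) x (V x) • Z x
          + dfn n f x (W x) • mlieBracket (𝓡 (2 * n + 1)) V Z x
          + (dfn n f x (V x) • mlieBracket (𝓡 (2 * n + 1)) W Z x
          + f x • mlieBracket (𝓡 (2 * n + 1)) V (mlieBracket (𝓡 (2 * n + 1)) W Z) x) := by
    intro V W hV hW
    rw [Filter.EventuallyEq.mlieBracket_vectorField_eq (Filter.EventuallyEq.refl _ V) (key hW),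
      mlieBracket_add_right (W := (fun y ↦ dfn n f y (W y)) • Z)
        (W₁ := f • mlieBracket (𝓡 (2 * n + 1)) W Z) (SmoothAt.smul (SmoothAt.dfn hf hW) hZ).diffAt
        (SmoothAt.smul hf (hW.bracket hZ)).diffAt,
      mlieBracket_smul_right (smoothFnAt_diff (SmoothAt.dfn hf hW)) hZ.diffAt,
      mlieBracket_smul_right (smoothFnAt_diff hf) (hW.bracket hZ).diffAt]
  have hle : minSmoothness ℝ 2 ≤ (∞ : WithTop ℕ∞) := by simpa using two_le_infty
  have hJ1 := leibniz_identity_mlieBracket_apply (hX.of_le hle) (hY.of_le hle)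
    (ContMDiffAt.of_le (SmoothAt.smul hf hZ) hle)
  have hJ2 := leibniz_identity_mlieBracket_apply (hX.of_le hle) (hY.of_le hle) (hZ.of_le hle)
  have e0 : (fun y ↦ f y • Z y) = f • Z := rfl
  rw [e0, expand hX hY, expand hY hX, (key (hX.bracket hY)).self_of_nhds] at hJ1
  simp only [Pi.add_apply, Pi.smul_apply'] at hJ1
  rw [hJ2] at hJ1
  have : (dfn n f x (mlieBracket (𝓡 (2 * n + 1)) X Y x)) • Z x =
      (dfn n (fun y ↦ dfn n f y (Y y)) x (X x) - dfn n (fun y ↦ dfn n f y (X y)) x (Y x)) • Z x := by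
    rw [sub_smul, eq_sub_iff_add_eq]
    linear_combination (norm := module) -hJ1
  exact smul_left_injective ℝ hz this

/-- A field of endomorphisms which maps smooth fields to smooth fields is smooth. -/
theorem contMDiffAt_endo_of_apply {K : Π x : M, Tan n x →L[ℝ] Tan n x} {x : M}
    (h : ∀ V : Π x : M, Tan n x, SmoothAt V x → SmoothAt (fun y ↦ K y (V y)) x) :
    ContMDiffAt (𝓡 (2 * n + 1)) ((𝓡 (2 * n + 1)).prod 𝓘(ℝ, ModelE n →L[ℝ] ModelE n)) ∞
      (fun x ↦ TotalSpace.mk' (ModelE n →L[ℝ] ModelE n)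
        (E := fun x : M ↦ Tan n x →L[ℝ] Tan n x) x (K x)) x := by
  rw [contMDiffAt_hom_bundle]
  refine ⟨contMDiffAt_id, ?_⟩
  set e := trivializationAt (ModelE n) (TangentSpace (𝓡 (2 * n + 1)) : M → Type _) x with he
  have hx : x ∈ e.baseSet := mem_baseSet_trivializationAt' x
  have hb : ∀ v : ModelE n, ContMDiffAt (𝓡 (2 * n + 1)) 𝓘(ℝ, ModelE n) ∞
      (fun y ↦ ContinuousLinearMap.inCoordinates (ModelE n) (TangentSpace (𝓡 (2 * n + 1)))
        (ModelE n) (TangentSpace (𝓡 (2 * n + 1))) x y x y (K y) v) x := by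
    intro v
    -- The test fields are those with constant coordinates in the trivialization.
    have hV : SmoothAt (fun y : M ↦ e.symmL ℝ y v) x := by
      refine ContMDiffOn.contMDiffAt (s := e.baseSet) ?_ (e.open_baseSet.mem_nhds hx)
      rw [e.contMDiffOn_section_baseSet_iff]
      refine (contMDiffOn_const (c := v)).congr fun y hy ↦ ?_
      simp [hy]
    have hKV := h _ hV
    rw [SmoothAt, contMDiffAt_section] at hKV
    refine hKV.congr_of_eventuallyEq ?_
    filter_upwards [e.open_baseSet.mem_nhds hx] with y hy
    simp [ContinuousLinearMap.inCoordinates, ← he, hy]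
  -- A linear map depends smoothly on its values on the standard basis.
  have hsum : ∀ L : ModelE n →L[ℝ] ModelE n, L = ∑ i : Fin (2 * n + 1),
      ContinuousLinearMap.smulRightL ℝ (ModelE n) (ModelE n) (EuclideanSpace.proj i)
        (L (EuclideanSpace.single i 1)) := by
    intro L
    refine ContinuousLinearMap.coe_injective ((EuclideanSpace.basisFun (Fin (2 * n + 1)) ℝ).toBasis.ext
      fun j ↦ ?_)
    simp
  have hrw := fun y ↦ hsum (ContinuousLinearMap.inCoordinates (ModelE n) (TangentSpace (𝓡 (2 * n + 1)))
        (ModelE n) (TangentSpace (𝓡 (2 * n + 1))) x y x y (K y))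
  simp only [TotalSpace.mk'] at hrw ⊢
  refine ContMDiffAt.congr_of_eventuallyEq ?_ (Filter.Eventually.of_forall hrw)
  refine contMDiffAt_finsetSum fun i _ ↦ ?_
  exact (ContinuousLinearMap.contMDiff _).contMDiffAt.comp x (hb _)

/-- Near every point there is a smooth frame with coefficient functionals that preserve
differentiability. -/
theorem exists_coordinate_frame (x : M) : ∃ (b : Fin (2 * n + 1) → Π x : M, Tan n x)
    (a : Fin (2 * n + 1) → Π x : M, Tan n x →ₗ[ℝ] ℝ), (∀ i, SmoothAt (b i) x) ∧
      (∀ (i) (X : Π x : M, Tan n x), SmoothAt X x → SmoothFnAt n (fun y ↦ a i y (X y)) x) ∧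
      (∀ (i) (X : Π x : M, Tan n x), DiffAt X x → DiffFnAt n (fun y ↦ a i y (X y)) x) ∧
      ∀ᶠ y in 𝓝 x, ∀ v : Tan n y, v = ∑ i, a i y v • b i y := by
  set e := trivializationAt (ModelE n) (TangentSpace (𝓡 (2 * n + 1)) : M → Type _) x with he
  have hx : x ∈ e.baseSet := mem_baseSet_trivializationAt' x
  let B := (EuclideanSpace.basisFun (Fin (2 * n + 1)) ℝ).toBasis
  refine ⟨e.localFrame B, e.localFrameCoeff (𝓡 (2 * n + 1)) B,
    fun i ↦ contMDiffAt_localFrame_of_mem _ e B i hx,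
    fun i X hX ↦ contMDiffAt_localFrameCoeff B hx hX i,
    fun i X hX ↦ mdifferentiableAt_localFrameCoeff B hx hX i, ?_⟩
  filter_upwards [e.open_baseSet.mem_nhds hx] with y hy v
  obtain ⟨V, -, rfl⟩ := exists_smoothAt_extend v
  exact Trivialization.eq_sum_localFrameCoeff_smul (s := V) (b := B) hy

end Calculus

namespace ContactTriad

/-! ### Linear algebra of a contact triad at one point. -/

section Pointwise

variable {n : ℕ} {M : Type*} [TopologicalSpace M] [ChartedSpace (ModelE n) M]
  [IsManifold (𝓡 (2 * n + 1)) ∞ M] (T : ContactTriad n M)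

theorem finiteDimensional_tan (n : ℕ) {M : Type*} [TopologicalSpace M] [ChartedSpace (ModelE n) M]
    (x : M) : FiniteDimensional ℝ (Tan n x) :=
  inferInstanceAs (FiniteDimensional ℝ (EuclideanSpace ℝ (Fin (2 * n + 1))))

theorem finrank_tan (n : ℕ) {M : Type*} [TopologicalSpace M] [ChartedSpace (ModelE n) M]
    (x : M) : Module.finrank ℝ (Tan n x) = 2 * n + 1 := by
  change Module.finrank ℝ (EuclideanSpace ℝ (Fin (2 * n + 1))) = _
  simp

theorem dlam_eq_cartanExpr {X Y : Π x : M, Tan n x} {x : M} (hX : DiffAt X x) (hY : DiffAt Y x) :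
    T.dlam x (X x) (Y x) = cartanExpr T.lam X Y x :=
  extDerivOneForm_apply T.smooth_lam hX hY

theorem dlam_swap (x : M) (v w : Tan n x) : T.dlam x v w = -T.dlam x w v := by
  obtain ⟨X, hX, rfl⟩ := exists_smoothAt_extend v
  obtain ⟨Y, hY, rfl⟩ := exists_smoothAt_extend w
  rw [T.dlam_eq_cartanExpr hX.diffAt hY.diffAt, T.dlam_eq_cartanExpr hY.diffAt hX.diffAt,
    cartanExpr_swap]

theorem dlam_self (x : M) (v : Tan n x) : T.dlam x v v = 0 := by
  linarith [T.dlam_swap x v v]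

theorem exists_lam_eq_one (x : M) : ∃ u : Tan n x, T.lam x u = 1 := by
  obtain ⟨v, hv⟩ := T.contact x
  have : ∃ u : Tan n x, T.lam x u ≠ 0 := by
    by_contra! h
    exact hv (by simp [wedgeTop, h])
  obtain ⟨u, hu⟩ := this
  exact ⟨(T.lam x u)⁻¹ • u, by simp [hu]⟩

/-- Positivity makes `dλ` nondegenerate on `ξ`. So for `λ(u) = 1` some `w` in `ξ` satisfies `dλ(w,
·) = dλ(u, ·)` on `ξ`, and `u - w` is the required vector; antisymmetry takes care of the remaining
direction `u`. -/
theorem exists_reeb (x : M) : ∃ v : Tan n x, T.lam x v = 1 ∧ ∀ w, T.dlam x v w = 0 := by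
  have := finiteDimensional_tan n x
  obtain ⟨u, hu⟩ := T.exists_lam_eq_one x
  let ξ : Submodule ℝ (Tan n x) := LinearMap.ker (T.lam x : Tan n x →ₗ[ℝ] ℝ)
  let φ : ξ →ₗ[ℝ] Module.Dual ℝ ξ :=
    ((T.dlam x).toLinearMap₁₂.domRestrict₁₂ ξ ξ)
  have hφ : ∀ v w : ξ, φ v w = T.dlam x v w := fun v w ↦ rfl
  have inj : Function.Injective φ := by
    rw [injective_iff_map_eq_zero]
    intro v hv
    by_contra hne
    have hv0 : T.lam x v = 0 := v.2
    have hpos := T.pos x v hv0 (by simpa using hne)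
    have := hφ v ⟨T.J x v, T.J_mem x v hv0⟩
    rw [hv] at this
    simp only [LinearMap.zero_apply] at this
    exact hpos.ne this
  have surj : Function.Surjective φ :=
    (LinearMap.injective_iff_surjective_of_finrank_eq_finrank
      Subspace.dual_finrank_eq.symm).1 inj
  obtain ⟨w, hw⟩ := surj (((T.dlam x).toLinearMap₁₂ u).domRestrict ξ)
  have hw' : ∀ z, T.lam x z = 0 → T.dlam x w z = T.dlam x u z := by
    intro z hz
    have := LinearMap.congr_fun hw ⟨z, hz⟩
    simpa [hφ] using this
  have hw0 : T.lam x w = 0 := w.2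
  refine ⟨u - w, by simp [hu, hw0], fun z ↦ ?_⟩
  have h1 : ∀ z, T.lam x z = 0 → T.dlam x (u - w) z = 0 := fun z hz ↦ by simp [hw' z hz]
  have h2 : T.dlam x (u - w) u = 0 := by
    have h3 := h1 w hw0
    have h4 := T.dlam_self x (u - w)
    simp only [map_sub] at h3 h4 ⊢
    linarith
  have h5 := h1 (z - T.lam x z • u) (by simp [hu])
  rw [map_sub, map_smul, h2] at h5
  simpa using h5

theorem lam_reeb (x : M) : T.lam x (T.reeb x) = 1 := by
  have h := T.exists_reeb x
  have e : T.reeb x = h.choose := dif_pos h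
  rw [e]; exact h.choose_spec.1

theorem dlam_reeb_left (x : M) (w : Tan n x) : T.dlam x (T.reeb x) w = 0 := by
  have h := T.exists_reeb x
  have e : T.reeb x = h.choose := dif_pos h
  rw [e]; exact h.choose_spec.2 w

theorem dlam_reeb_right (x : M) (w : Tan n x) : T.dlam x w (T.reeb x) = 0 := by
  rw [dlam_swap, dlam_reeb_left, neg_zero]

theorem J_reeb' (x : M) : T.J x (T.reeb x) = 0 := T.J_reeb x

theorem lam_proj (x : M) (v : Tan n x) : T.lam x (T.proj x v) = 0 := by
  simp [proj, lam_reeb]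

theorem J_proj (x : M) (v : Tan n x) : T.J x (T.proj x v) = T.J x v := by
  simp [proj, J_reeb']

theorem proj_add_reeb (x : M) (v : Tan n x) : T.proj x v + T.lam x v • T.reeb x = v := by
  simp [proj]

theorem proj_of_lam_eq_zero {x : M} {v : Tan n x} (h : T.lam x v = 0) : T.proj x v = v := by
  simp [proj, h]

theorem proj_reeb (x : M) : T.proj x (T.reeb x) = 0 := by simp [proj, lam_reeb]

theorem lam_J (x : M) (v : Tan n x) : T.lam x (T.J x v) = 0 := by
  rw [← J_proj]; exact T.J_mem x _ (T.lam_proj x v)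

theorem J_J (x : M) (v : Tan n x) : T.J x (T.J x v) = -T.proj x v := by
  rw [← T.J_proj x v]; exact T.J_sq x _ (T.lam_proj x v)

theorem proj_J (x : M) (v : Tan n x) : T.proj x (T.J x v) = T.J x v :=
  T.proj_of_lam_eq_zero (T.lam_J x v)

/-- The projection to `ξ` as a linear map. -/
def projL (x : M) : Tan n x →ₗ[ℝ] Tan n x :=
  -((T.J x : Tan n x →ₗ[ℝ] Tan n x) ∘ₗ (T.J x : Tan n x →ₗ[ℝ] Tan n x))

theorem projL_apply (x : M) (v : Tan n x) : T.projL x v = T.proj x v := by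
  simp [projL, J_J]

theorem proj_add (x : M) (v w : Tan n x) : T.proj x (v + w) = T.proj x v + T.proj x w := by
  simp only [← projL_apply, map_add]

theorem proj_sub (x : M) (v w : Tan n x) : T.proj x (v - w) = T.proj x v - T.proj x w := by
  simp only [← projL_apply, map_sub]

theorem proj_neg (x : M) (v : Tan n x) : T.proj x (-v) = -T.proj x v := by
  simp only [← projL_apply, map_neg]

theorem proj_smul (x : M) (a : ℝ) (v : Tan n x) : T.proj x (a • v) = a • T.proj x v := by
  simp only [← projL_apply, map_smul]

theorem proj_zero (x : M) : T.proj x 0 = 0 := by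
  simp only [← projL_apply, map_zero]

theorem dlam_proj_left (x : M) (v w : Tan n x) : T.dlam x (T.proj x v) w = T.dlam x v w := by
  simp [proj, dlam_reeb_left]

theorem dlam_proj_right (x : M) (v w : Tan n x) : T.dlam x v (T.proj x w) = T.dlam x v w := by
  simp [proj, dlam_reeb_right]

theorem g_apply (x : M) (v w : Tan n x) :
    T.g x v w = T.dlam x v (T.J x w) + T.lam x v * T.lam x w := rfl

theorem dlam_J_comm (x : M) (v w : Tan n x) : T.dlam x v (T.J x w) = T.dlam x w (T.J x v) := by
  have := T.symm x _ _ (T.lam_proj x v) (T.lam_proj x w)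
  rw [J_proj, J_proj] at this
  rw [← T.dlam_proj_left x v, ← T.dlam_proj_left x w]
  exact this

theorem g_symm (x : M) (v w : Tan n x) : T.g x v w = T.g x w v := by
  rw [g_apply, g_apply, dlam_J_comm]; ring

/-- This recovers `dλ` from `g` and `J`, so that a connection preserving both also preserves `dλ`.
-/
theorem g_J_left_eq_dlam (x : M) (v w : Tan n x) : T.g x (T.J x v) w = T.dlam x v w := by
  rw [g_apply, lam_J, zero_mul, add_zero, dlam_J_comm, J_J, map_neg, dlam_proj_right,
    ← dlam_swap]

theorem g_J_left (x : M) (v w : Tan n x) : T.g x (T.J x v) w = -T.g x v (T.J x w) := by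
  rw [T.g_symm x v, g_J_left_eq_dlam, g_J_left_eq_dlam, dlam_swap]

theorem g_J_J (x : M) (v w : Tan n x) : T.g x (T.J x v) (T.J x w) = T.g x (T.proj x v) w := by
  rw [T.g_symm, g_J_left, J_J, map_neg, neg_neg, g_symm]

theorem g_J_self (x : M) (v : Tan n x) : T.g x v (T.J x v) = 0 := by
  have := T.g_J_left x v v
  rw [T.g_symm] at this
  linarith

theorem g_reeb_left (x : M) (v : Tan n x) : T.g x (T.reeb x) v = T.lam x v := by
  rw [g_apply, dlam_reeb_left, lam_reeb]; ring

theorem g_reeb_right (x : M) (v : Tan n x) : T.g x v (T.reeb x) = T.lam x v := by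
  rw [g_symm, g_reeb_left]

theorem g_proj_left (x : M) (v w : Tan n x) : T.g x (T.proj x v) w = T.g x v (T.proj x w) := by
  simp [proj, g_reeb_left, g_reeb_right]; ring

theorem g_proj_left_of_lam {x : M} (v : Tan n x) {w : Tan n x} (h : T.lam x w = 0) :
    T.g x (T.proj x v) w = T.g x v w := by
  rw [g_proj_left, T.proj_of_lam_eq_zero h]

theorem g_proj_right_of_lam {x : M} {v : Tan n x} (w : Tan n x) (h : T.lam x v = 0) :
    T.g x v (T.proj x w) = T.g x v w := by
  rw [← g_proj_left, T.proj_of_lam_eq_zero h]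

theorem g_pos {x : M} {v : Tan n x} (hv : v ≠ 0) : 0 < T.g x v v := by
  rw [g_apply, ← J_proj, ← dlam_proj_left]
  by_cases h : T.proj x v = 0
  · have h1 := T.proj_add_reeb x v
    rw [h, zero_add] at h1
    have : T.lam x v ≠ 0 := by
      intro h0
      rw [h0, zero_smul] at h1
      exact hv h1.symm
    rw [h]
    simpa using this
  · have : 0 < T.dlam x (T.proj x v) (T.J x (T.proj x v)) := T.pos x _ (T.lam_proj x v) h
    nlinarith [mul_self_nonneg (T.lam x v)]

theorem eq_zero_of_g_self {x : M} {v : Tan n x} (h : T.g x v v = 0) : v = 0 := by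
  by_contra hv
  exact (T.g_pos hv).ne' h

theorem eq_of_forall_g {x : M} {v w : Tan n x} (h : ∀ z, T.g x v z = T.g x w z) : v = w := by
  rw [← sub_eq_zero]
  apply T.eq_zero_of_g_self
  rw [LinearMap.map_sub₂, h, sub_self]

theorem eq_of_forall_g_xi {x : M} {v w : Tan n x} (hv : T.lam x v = 0) (hw : T.lam x w = 0)
    (h : ∀ z, T.lam x z = 0 → T.g x v z = T.g x w z) : v = w := by
  rw [← sub_eq_zero]
  apply T.eq_zero_of_g_self
  rw [LinearMap.map_sub₂, h _ (by simp [hv, hw]), sub_self]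

end Pointwise

/-! ### Regularity of `λ`, `J`, `dλ` and `g` on fields. -/

section Smoothness

variable {n : ℕ} {M : Type*} [TopologicalSpace M] [ChartedSpace (ModelE n) M]
  [IsManifold (𝓡 (2 * n + 1)) ∞ M] (T : ContactTriad n M)

theorem smooth_lam_apply {X : Π x : M, Tan n x} {x : M} (hX : SmoothAt X x) :
    SmoothFnAt n (fun y ↦ T.lam y (X y)) x := by
  have : ContMDiffAt (𝓡 (2 * n + 1)) ((𝓡 (2 * n + 1)).prod 𝓘(ℝ)) ∞
      (fun m ↦ TotalSpace.mk' ℝ (E := Bundle.Trivial M ℝ) m (T.lam m (X m))) x :=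
    ContMDiffAt.clm_bundle_apply (F₁ := ModelE n) (T.smooth_lam x) hX
  rw [contMDiffAt_totalSpace] at this
  exact this.2

theorem diff_lam_apply {X : Π x : M, Tan n x} {x : M} (hX : DiffAt X x) :
    DiffFnAt n (fun y ↦ T.lam y (X y)) x := T.smooth_lam.mdifferentiableAt_apply hX

theorem smoothAt_J {X : Π x : M, Tan n x} {x : M} (hX : SmoothAt X x) :
    SmoothAt (fun y ↦ T.J y (X y)) x :=
  ContMDiffAt.clm_bundle_apply (F₁ := ModelE n) (T.smooth_J x) hX

theorem diffAt_J {X : Π x : M, Tan n x} {x : M} (hX : DiffAt X x) :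
    DiffAt (fun y ↦ T.J y (X y)) x :=
  MDifferentiableAt.clm_bundle_apply (F₁ := ModelE n)
    ((T.smooth_J x).mdifferentiableAt (by simp)) hX

theorem smooth_dlam {X Y : Π x : M, Tan n x} {x : M} (hX : SmoothAt X x) (hY : SmoothAt Y x) :
    SmoothFnAt n (fun y ↦ T.dlam y (X y) (Y y)) x := by
  have h : SmoothFnAt n (cartanExpr T.lam X Y) x :=
    ((SmoothAt.dfn (T.smooth_lam_apply hY) hX).sub (SmoothAt.dfn (T.smooth_lam_apply hX) hY)).sub
      (T.smooth_lam_apply (hX.bracket hY))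
  refine h.congr_of_eventuallyEq ?_
  filter_upwards [hX.eventually_diffAt, hY.eventually_diffAt] with y h1 h2
  exact T.dlam_eq_cartanExpr h1 h2

/-- Covariant derivatives act on merely differentiable fields, for which Cartan's formula already
uses up the one derivative. The fields are therefore expanded in a smooth local frame, and only `dλ`
of the frame fields is differentiated. -/
theorem diff_dlam {X Y : Π x : M, Tan n x} {x : M} (hX : DiffAt X x) (hY : DiffAt Y x) :
    DiffFnAt n (fun y ↦ T.dlam y (X y) (Y y)) x := by
  obtain ⟨b, a, hb, -, ha, hba⟩ := exists_coordinate_frame (n := n) x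
  have h : DiffFnAt n (fun y ↦ ∑ i, ∑ j, a i y (X y) * (a j y (Y y) * T.dlam y (b i y) (b j y))) x :=
    diffFnAt_sum fun i _ ↦ diffFnAt_sum fun j _ ↦ (ha i X hX).mul
      ((ha j Y hY).mul (smoothFnAt_diff (T.smooth_dlam (hb i) (hb j))))
  refine h.congr_of_eventuallyEq ?_
  filter_upwards [hba] with y hy
  conv_lhs => rw [hy (X y), hy (Y y)]
  simp only [map_sum, map_smul, sum_apply, smul_apply,
    smul_eq_mul, Finset.mul_sum]
  rw [Finset.sum_comm]
  exact Finset.sum_congr rfl fun i _ ↦ Finset.sum_congr rfl fun j _ ↦ by ring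

theorem smooth_g {X Y : Π x : M, Tan n x} {x : M} (hX : SmoothAt X x) (hY : SmoothAt Y x) :
    SmoothFnAt n (fun y ↦ T.g y (X y) (Y y)) x :=
  (T.smooth_dlam hX (T.smoothAt_J hY)).add ((T.smooth_lam_apply hX).mul (T.smooth_lam_apply hY))

theorem diff_g {X Y : Π x : M, Tan n x} {x : M} (hX : DiffAt X x) (hY : DiffAt Y x) :
    DiffFnAt n (fun y ↦ T.g y (X y) (Y y)) x :=
  (T.diff_dlam hX (T.diffAt_J hY)).add ((T.diff_lam_apply hX).mul (T.diff_lam_apply hY))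

end Smoothness

end ContactTriad

/-! ### Unitary frames, smoothness of the Reeb field, and `d(dλ) = 0`. -/

section Extend

variable {n : ℕ} {M : Type*} [TopologicalSpace M] [ChartedSpace (ModelE n) M]
  [IsManifold (𝓡 (2 * n + 1)) ∞ M]

/-- Every tangent vector extends to a vector field that is smooth near the base point. -/
theorem exists_eventually_smoothAt_extend {x : M} (v : Tan n x) :
    ∃ X : Π x : M, Tan n x, (∀ᶠ y in 𝓝 x, SmoothAt X y) ∧ X x = v := by
  refine ⟨extend (ModelE n) v, ?_, extend_apply_self (ModelE n) v⟩
  obtain ⟨s, hs, h⟩ := exists_contMDiffOn_extend (k := ∞) (𝓡 (2 * n + 1)) (ModelE n) v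
  filter_upwards [eventually_mem_nhds_iff.2 hs] with y hy
  exact h.contMDiffAt hy

end Extend

namespace ContactTriad

variable {n : ℕ} {M : Type*} [TopologicalSpace M] [ChartedSpace (ModelE n) M]
  [IsManifold (𝓡 (2 * n + 1)) ∞ M] (T : ContactTriad n M)

/-- The fields `E i` are smooth at `y`, and there they form a unitary family in `ξ`. -/
structure IsUnitaryAt {k : ℕ} (E : Fin k → Π x : M, Tan n x) (y : M) : Prop where
  smooth : ∀ i, SmoothAt (E i) y
  horizontal : ∀ i, T.lam y (E i y) = 0
  orthonormal : ∀ i j, T.g y (E i y) (E j y) = if i = j then 1 else 0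
  orthogonal : ∀ i j, T.g y (E i y) (T.J y (E j y)) = 0

/-- A unitary family with fewer than `n` members has a nonzero orthogonal vector. -/
theorem exists_orthogonal {k : ℕ} (hk : k < n) (x : M) (e : Fin k → Tan n x) :
    ∃ v : Tan n x, v ≠ 0 ∧ T.lam x v = 0 ∧ (∀ i, T.g x (e i) v = 0) ∧
      ∀ i, T.g x (T.J x (e i)) v = 0 := by
  have := finiteDimensional_tan n x
  let Φ : Tan n x →ₗ[ℝ] (Fin k → ℝ) × (Fin k → ℝ) × ℝ :=
    (LinearMap.pi fun i ↦ T.g x (e i)).prod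
      ((LinearMap.pi fun i ↦ T.g x (T.J x (e i))).prod (T.lam x : Tan n x →ₗ[ℝ] ℝ))
  -- There are `2k + 1` linear conditions on a space of dimension `2n + 1`.
  have hker : LinearMap.ker Φ ≠ ⊥ := by
    apply LinearMap.ker_ne_bot_of_finrank_lt
    rw [finrank_tan]
    simp
    omega
  obtain ⟨v, hv, hne⟩ := Submodule.exists_mem_ne_zero_of_ne_bot hker
  have hv' : Φ v = 0 := hv
  refine ⟨v, hne, congrArg (fun p ↦ p.2.2) hv', fun i ↦ ?_, fun i ↦ ?_⟩
  · exact congrFun (congrArg (fun p ↦ p.1) hv') i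
  · exact congrFun (congrArg (fun p ↦ p.2.1) hv') i

/-- One step of the unitary Gram–Schmidt process. -/
theorem IsUnitaryAt.extend {k : ℕ} (hk : k < n) {x : M} {E : Fin k → Π x : M, Tan n x}
    (hE : ∀ᶠ y in 𝓝 x, T.IsUnitaryAt E y) :
    ∃ E' : Fin (k + 1) → Π x : M, Tan n x, ∀ᶠ y in 𝓝 x, T.IsUnitaryAt E' y := by
  obtain ⟨v, hv0, hvl, hvE, hvF⟩ := T.exists_orthogonal hk x (fun i ↦ E i x)
  obtain ⟨V, hV, hVx⟩ := exists_eventually_smoothAt_extend v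
  obtain ⟨u, hu⟩ := T.exists_lam_eq_one x
  obtain ⟨u', hu', hux⟩ := exists_eventually_smoothAt_extend u
  have hlam : ∀ᶠ y in 𝓝 x, T.lam y (u' y) ≠ 0 := by
    refine (T.smooth_lam_apply hu'.self_of_nhds).continuousAt.eventually_ne ?_
    rw [hux, hu]; exact one_ne_zero
  -- The field is moved into `ξ` along `u'` and not along `R`: the smoothness of `R` is itself
  -- deduced from these frames.
  let V' : Π x : M, Tan n x := fun y ↦ V y - (T.lam y (V y) * (T.lam y (u' y))⁻¹) • u' y
  let W : Π x : M, Tan n x := fun y ↦ V' y - ∑ i, (T.g y (E i y) (V' y) • E i y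
    + T.g y (T.J y (E i y)) (V' y) • T.J y (E i y))
  have hinv : ∀ {f : M → ℝ} {y : M}, f y ≠ 0 → SmoothFnAt n f y → SmoothFnAt n (fun z ↦ (f z)⁻¹) y :=
    fun h hf ↦ (contDiffAt_inv ℝ h).comp_contMDiffAt hf
  have hWs : ∀ᶠ y in 𝓝 x, SmoothAt W y := by
    filter_upwards [hE, hV, hu', hlam] with y h1 h2 h3 h4
    have hV's : SmoothAt V' y := h2.sub (SmoothAt.smul
      ((T.smooth_lam_apply h2).mul (hinv h4 (T.smooth_lam_apply h3))) h3)
    exact hV's.sub (SmoothAt.sum fun i _ ↦ (SmoothAt.smul (T.smooth_g (h1.smooth i) hV's)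
      (h1.smooth i)).add (SmoothAt.smul (T.smooth_g (T.smoothAt_J (h1.smooth i)) hV's)
      (T.smoothAt_J (h1.smooth i))))
  have hV'l : ∀ᶠ y in 𝓝 x, T.lam y (V' y) = 0 := by
    filter_upwards [hlam] with y h4
    simp [V', h4]
  have hWl : ∀ᶠ y in 𝓝 x, T.lam y (W y) = 0 := by
    filter_upwards [hE, hV'l] with y h1 h2
    simp [W, h2, h1.horizontal, T.lam_J]
  have hEW : ∀ᶠ y in 𝓝 x, ∀ i, T.g y (E i y) (W y) = 0 ∧ T.g y (T.J y (E i y)) (W y) = 0 := by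
    filter_upwards [hE] with y h1 i
    have hFE : ∀ i j, T.g y (T.J y (E i y)) (E j y) = 0 := fun i j ↦ by
      rw [T.g_J_left, h1.orthogonal, neg_zero]
    have hFF : ∀ i j, T.g y (T.J y (E i y)) (T.J y (E j y)) = if i = j then 1 else 0 := fun i j ↦ by
      rw [T.g_J_J, T.proj_of_lam_eq_zero (h1.horizontal i), h1.orthonormal]
    constructor
    · simp [W, h1.orthonormal, h1.orthogonal]
    · simp [W, hFE, hFF]
  have hWx : W x = v := by
    have h1 := hE.self_of_nhds
    have : V' x = v := by simp [V', hVx, hvl]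
    simp [W, this, hvE, hvF]
  have hpos : ∀ᶠ y in 𝓝 x, T.g y (W y) (W y) ≠ 0 := by
    refine (T.smooth_g hWs.self_of_nhds hWs.self_of_nhds).continuousAt.eventually_ne ?_
    rw [hWx]; exact (T.g_pos hv0).ne'
  let N : Π x : M, Tan n x := fun y ↦ (√(T.g y (W y) (W y)))⁻¹ • W y
  refine ⟨Fin.snoc (α := fun _ ↦ Π x : M, Tan n x) E N, ?_⟩
  filter_upwards [hE, hWs, hWl, hEW, hpos] with y h1 h2 h3 h4 h5
  have hgpos : 0 < T.g y (W y) (W y) := T.g_pos fun h ↦ h5 (by simp [h])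
  have hNs : SmoothAt N y := by
    refine SmoothAt.smul (hinv (Real.sqrt_ne_zero'.2 hgpos) ?_) h2
    exact ContDiffAt.comp_contMDiffAt (f := fun z ↦ T.g z (W z) (W z)) (Real.contDiffAt_sqrt h5)
      (T.smooth_g h2 h2)
  have hNN : T.g y (N y) (N y) = 1 := by
    have hs := Real.mul_self_sqrt hgpos.le
    have hne := Real.sqrt_ne_zero'.2 hgpos
    simp only [N, map_smul, LinearMap.smul_apply, smul_eq_mul]
    field_simp
    linarith [hs]
  have hEN : ∀ i, T.g y (E i y) (N y) = 0 := fun i ↦ by simp [N, (h4 i).1]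
  have hFN : ∀ i, T.g y (T.J y (E i y)) (N y) = 0 := fun i ↦ by simp [N, (h4 i).2]
  refine ⟨fun i ↦ ?_, fun i ↦ ?_, fun i j ↦ ?_, fun i j ↦ ?_⟩
  · refine Fin.lastCases ?_ (fun i ↦ ?_) i
    · simpa using hNs
    · simpa using h1.smooth i
  · refine Fin.lastCases ?_ (fun i ↦ ?_) i
    · simp [N, h3]
    · simpa using h1.horizontal i
  · refine Fin.lastCases ?_ (fun i ↦ ?_) i <;> refine Fin.lastCases ?_ (fun j ↦ ?_) j
    · simpa using hNN
    · simpa [Fin.ext_iff, j.2.ne'] using (T.g_symm y _ _).trans (hEN j)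
    · simpa [Fin.ext_iff, i.2.ne] using hEN i
    · simpa using h1.orthonormal i j
  · refine Fin.lastCases ?_ (fun i ↦ ?_) i <;> refine Fin.lastCases ?_ (fun j ↦ ?_) j
    · simpa using T.g_J_self y (N y)
    · simpa using (T.g_symm y _ _).trans (hFN j)
    · have := T.g_J_left y (E i y) (N y)
      rw [hFN, eq_comm, neg_eq_zero] at this
      simpa using this
    · simpa using h1.orthogonal i j

/-- Around every point there is an almost contact frame. -/
theorem exists_frame (x : M) : ∃ B : T.Frame, x ∈ B.U := by
  have h : ∀ k ≤ n, ∃ E : Fin k → Π x : M, Tan n x, ∀ᶠ y in 𝓝 x, T.IsUnitaryAt E y := by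
    intro k
    induction k with
    | zero => exact fun _ ↦ ⟨Fin.elim0, Filter.Eventually.of_forall fun y ↦
        ⟨fun i ↦ i.elim0, fun i ↦ i.elim0, fun i ↦ i.elim0, fun i ↦ i.elim0⟩⟩
    | succ k ih =>
      intro hk
      obtain ⟨E, hE⟩ := ih (by omega)
      exact IsUnitaryAt.extend T (by omega) hE
  obtain ⟨E, hE⟩ := h n le_rfl
  obtain ⟨U, hU, hUo, hxU⟩ := eventually_nhds_iff.1 hE
  exact ⟨⟨U, hUo, E, fun i ↦ smoothOnSet_of_forall fun y hy ↦ (hU y hy).smooth i,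
    fun i y hy ↦ (hU y hy).horizontal i, fun i j y hy ↦ (hU y hy).orthonormal i j,
    fun i j y hy ↦ (hU y hy).orthogonal i j⟩, hxU⟩

namespace Frame

variable {T} (B : T.Frame)

theorem smoothAt_E (i : Fin n) {x : M} (hx : x ∈ B.U) : SmoothAt (B.E i) x :=
  (B.smooth i).smoothAt B.isOpen hx

theorem smoothAt_F (i : Fin n) {x : M} (hx : x ∈ B.U) : SmoothAt (B.F i) x :=
  T.smoothAt_J (B.smoothAt_E i hx)

theorem lam_E (i : Fin n) {x : M} (hx : x ∈ B.U) : T.lam x (B.E i x) = 0 := B.horizontal i x hx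

theorem lam_F (i : Fin n) (x : M) : T.lam x (B.F i x) = 0 := T.lam_J x _

theorem J_E (i : Fin n) (x : M) : T.J x (B.E i x) = B.F i x := rfl

theorem J_F (i : Fin n) {x : M} (hx : x ∈ B.U) : T.J x (B.F i x) = -B.E i x := by
  rw [F, T.J_J, T.proj_of_lam_eq_zero (B.lam_E i hx)]

theorem g_E_E (i j : Fin n) {x : M} (hx : x ∈ B.U) :
    T.g x (B.E i x) (B.E j x) = if i = j then 1 else 0 := B.orthonormal i j x hx

theorem g_E_F (i j : Fin n) {x : M} (hx : x ∈ B.U) : T.g x (B.E i x) (B.F j x) = 0 :=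
  B.orthogonal i j x hx

theorem g_F_E (i j : Fin n) {x : M} (hx : x ∈ B.U) : T.g x (B.F i x) (B.E j x) = 0 := by
  rw [T.g_symm, B.g_E_F j i hx]

theorem g_F_F (i j : Fin n) {x : M} (hx : x ∈ B.U) :
    T.g x (B.F i x) (B.F j x) = if i = j then 1 else 0 := by
  rw [F, F, T.g_J_J, T.proj_of_lam_eq_zero (B.lam_E i hx), B.g_E_E i j hx]

/-- Expansion of a tangent vector in an almost contact frame. -/
theorem expand {x : M} (hx : x ∈ B.U) (v : Tan n x) :
    v = ∑ k, (T.g x (B.E k x) v • B.E k x + T.g x (B.F k x) v • B.F k x)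
      + T.lam x v • T.reeb x := by
  have := finiteDimensional_tan n x
  let Φ : Tan n x →ₗ[ℝ] (Fin n → ℝ) × (Fin n → ℝ) × ℝ :=
    (LinearMap.pi fun i ↦ T.g x (B.E i x)).prod
      ((LinearMap.pi fun i ↦ T.g x (B.F i x)).prod (T.lam x : Tan n x →ₗ[ℝ] ℝ))
  have hE : ∀ (a b : Fin n → ℝ) (c : ℝ) (i : Fin n), T.g x (B.E i x)
      (∑ k, (a k • B.E k x + b k • B.F k x) + c • T.reeb x) = a i := by
    intro a b c i
    simp [B.g_E_E i _ hx, B.g_E_F i _ hx, T.g_reeb_right, B.lam_E i hx]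
  have hF : ∀ (a b : Fin n → ℝ) (c : ℝ) (i : Fin n), T.g x (B.F i x)
      (∑ k, (a k • B.E k x + b k • B.F k x) + c • T.reeb x) = b i := by
    intro a b c i
    simp [B.g_F_E i _ hx, B.g_F_F i _ hx, T.g_reeb_right, B.lam_F]
  have hR : ∀ (a b : Fin n → ℝ) (c : ℝ), T.lam x
      (∑ k, (a k • B.E k x + b k • B.F k x) + c • T.reeb x) = c := by
    intro a b c
    simp [B.lam_E _ hx, B.lam_F, T.lam_reeb]
  have hsurj : Function.Surjective Φ := by
    rintro ⟨a, b, c⟩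
    refine ⟨∑ k, (a k • B.E k x + b k • B.F k x) + c • T.reeb x, ?_⟩
    ext i
    · exact hE a b c i
    · exact hF a b c i
    · exact hR a b c
  have hinj : Function.Injective Φ := by
    refine (LinearMap.injective_iff_surjective_of_finrank_eq_finrank ?_).2 hsurj
    rw [finrank_tan]
    simp
    ring
  apply hinj
  ext i
  · exact (hE (fun k ↦ T.g x (B.E k x) v) (fun k ↦ T.g x (B.F k x) v) (T.lam x v) i).symm
  · exact (hF (fun k ↦ T.g x (B.E k x) v) (fun k ↦ T.g x (B.F k x) v) (T.lam x v) i).symm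
  · exact (hR (fun k ↦ T.g x (B.E k x) v) (fun k ↦ T.g x (B.F k x) v) (T.lam x v)).symm

theorem g_eq_sum {x : M} (hx : x ∈ B.U) (v w : Tan n x) :
    T.g x v w = ∑ k, (T.g x (B.E k x) v * T.g x (B.E k x) w
      + T.g x (B.F k x) v * T.g x (B.F k x) w) + T.lam x v * T.lam x w := by
  conv_lhs => rw [B.expand hx v]
  simp [T.g_reeb_left]

end Frame

/-- The Reeb field is smooth. -/
theorem smoothAt_reeb (x : M) : SmoothAt T.reeb x := by
  obtain ⟨B, hx⟩ := T.exists_frame x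
  obtain ⟨u, hu⟩ := T.exists_lam_eq_one x
  obtain ⟨u', hu', hux⟩ := exists_smoothAt_extend u
  -- Removing the frame components of `u'` leaves `λ(u') R`.
  have hs : SmoothAt (fun y ↦ (T.lam y (u' y))⁻¹ • (u' y -
      ∑ k, (T.g y (B.E k y) (u' y) • B.E k y + T.g y (B.F k y) (u' y) • B.F k y))) x := by
    refine SmoothAt.smul ?_ (hu'.sub (SmoothAt.sum fun k _ ↦
      (SmoothAt.smul (T.smooth_g (B.smoothAt_E k hx) hu') (B.smoothAt_E k hx)).add
        (SmoothAt.smul (T.smooth_g (B.smoothAt_F k hx) hu') (B.smoothAt_F k hx))))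
    exact (contDiffAt_inv ℝ (by rw [hux, hu]; exact one_ne_zero)).comp_contMDiffAt
      (T.smooth_lam_apply hu')
  refine hs.congr ?_
  have hne : ∀ᶠ y in 𝓝 x, T.lam y (u' y) ≠ 0 :=
    (T.smooth_lam_apply hu').continuousAt.eventually_ne (by rw [hux, hu]; exact one_ne_zero)
  filter_upwards [B.isOpen.mem_nhds hx, hne] with y hy h0
  rw [sub_eq_of_eq_add' (B.expand hy (u' y)), smul_smul, inv_mul_cancel₀ h0, one_smul]

theorem smoothAt_proj {X : Π x : M, Tan n x} {x : M} (hX : SmoothAt X x) :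
    SmoothAt (fun y ↦ T.proj y (X y)) x :=
  hX.sub (SmoothAt.smul (T.smooth_lam_apply hX) (T.smoothAt_reeb x))

/-- Every vector of `ξ` extends to a section of `ξ` that is smooth at the base point. -/
theorem exists_xi_extend {x : M} {v : Tan n x} (hv : T.lam x v = 0) :
    ∃ X : Π x : M, Tan n x, SmoothAt X x ∧ (∀ y, T.lam y (X y) = 0) ∧ X x = v := by
  obtain ⟨X, hX, hXx⟩ := exists_smoothAt_extend v
  exact ⟨fun y ↦ T.proj y (X y), T.smoothAt_proj hX, fun y ↦ T.lam_proj y _, by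
    change T.proj x (X x) = v
    rw [hXx, T.proj_of_lam_eq_zero hv]⟩

/-- `d(dλ) = 0`, evaluated on smooth fields. -/
theorem cyclic_dlam {X Y Z : Π x : M, Tan n x} {x : M} (hX : SmoothAt X x) (hY : SmoothAt Y x)
    (hZ : SmoothAt Z x) :
    dfn n (fun y ↦ T.dlam y (Y y) (Z y)) x (X x) + dfn n (fun y ↦ T.dlam y (Z y) (X y)) x (Y x)
      + dfn n (fun y ↦ T.dlam y (X y) (Y y)) x (Z x)
      - T.dlam x (mlieBracket (𝓡 (2 * n + 1)) X Y x) (Z x)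
      - T.dlam x (mlieBracket (𝓡 (2 * n + 1)) Y Z x) (X x)
      - T.dlam x (mlieBracket (𝓡 (2 * n + 1)) Z X x) (Y x) = 0 := by
  have : IsManifold (𝓡 (2 * n + 1)) (minSmoothness ℝ 3) M :=
    IsManifold.of_le (n := ∞) (by simpa using three_le_infty)
  have hle : minSmoothness ℝ 2 ≤ (∞ : WithTop ℕ∞) := by simpa using two_le_infty
  have hd : ∀ {V W : Π x : M, Tan n x} (v : Tan n x), SmoothAt V x → SmoothAt W x →
      dfn n (fun y ↦ T.dlam y (V y) (W y)) x v =
        dfn n (fun y ↦ dfn n (fun z ↦ T.lam z (W z)) y (V y)) x v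
        - dfn n (fun y ↦ dfn n (fun z ↦ T.lam z (V z)) y (W y)) x v
        - dfn n (fun y ↦ T.lam y (mlieBracket (𝓡 (2 * n + 1)) V W y)) x v := by
    intro V W v hV hW
    have e : ∀ᶠ y in 𝓝 x, T.dlam y (V y) (W y) = dfn n (fun z ↦ T.lam z (W z)) y (V y)
        - dfn n (fun z ↦ T.lam z (V z)) y (W y)
        - T.lam y (mlieBracket (𝓡 (2 * n + 1)) V W y) := by
      filter_upwards [hV.eventually_diffAt, hW.eventually_diffAt] with y h1 h2
      exact T.dlam_eq_cartanExpr h1 h2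
    have s1 := smoothFnAt_diff (SmoothAt.dfn (T.smooth_lam_apply hW) hV)
    have s2 := smoothFnAt_diff (SmoothAt.dfn (T.smooth_lam_apply hV) hW)
    have s3 : DiffFnAt n (fun y ↦ dfn n (fun z ↦ T.lam z (W z)) y (V y)
      - dfn n (fun z ↦ T.lam z (V z)) y (W y)) x := s1.sub s2
    rw [dfn_congr e, dfn_sub s3 (T.diff_lam_apply (hV.bracket hW).diffAt), dfn_sub s1 s2]
  have hc : ∀ {V W : Π x : M, Tan n x}, SmoothAt V x → SmoothAt W x →
      T.dlam x (V x) (W x) = dfn n (fun z ↦ T.lam z (W z)) x (V x)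
        - dfn n (fun z ↦ T.lam z (V z)) x (W x) - T.lam x (mlieBracket (𝓡 (2 * n + 1)) V W x) :=
    fun hV hW ↦ T.dlam_eq_cartanExpr hV.diffAt hW.diffAt
  rw [hd _ hX hY, hd _ hY hZ, hd _ hZ hX, hc (hX.bracket hY) hZ, hc (hY.bracket hZ) hX,
    hc (hZ.bracket hX) hY, dfn_bracket (T.smooth_lam_apply hZ) hX hY,
    dfn_bracket (T.smooth_lam_apply hX) hY hZ, dfn_bracket (T.smooth_lam_apply hY) hZ hX]
  -- The second derivatives of functions now cancel; what is left is `λ` applied to the Jacobi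
  -- identity.
  have hJ := congrArg (T.lam x)
    (leibniz_identity_mlieBracket_apply (hX.of_le hle) (hY.of_le hle) (hZ.of_le hle))
  rw [map_add, mlieBracket_swap_apply (V := X), mlieBracket_swap_apply (V := Y) (W := mlieBracket _ X Z),
    mlieBracket_swap (V := X) (W := Z)] at hJ
  have hneg : mlieBracket (𝓡 (2 * n + 1)) (-mlieBracket (𝓡 (2 * n + 1)) Z X) Y x =
      -mlieBracket (𝓡 (2 * n + 1)) (mlieBracket (𝓡 (2 * n + 1)) Z X) Y x := by
    have := mlieBracket_const_smul_left (c := (-1 : ℝ)) (W := Y) (hZ.bracket hX).diffAt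
    simpa using this
  rw [hneg] at hJ
  simp only [map_neg] at hJ
  linarith

end ContactTriad

/-! ### Connections with parallel `g`, `J` and `R`. -/

namespace ContactTriad

variable {n : ℕ} {M : Type*} [TopologicalSpace M] [ChartedSpace (ModelE n) M]
  [IsManifold (𝓡 (2 * n + 1)) ∞ M] {T : ContactTriad n M}

namespace Frame

variable (B : T.Frame)

/-- The flat covariant derivative on the domain of an almost contact frame, which makes the frame
parallel. -/
def flat (Y : Π x : M, Tan n x) (x : M) : Tan n x →L[ℝ] Tan n x :=
  ∑ k, ((dfn n (fun y ↦ T.g y (B.E k y) (Y y)) x).smulRight (B.E k x)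
      + (dfn n (fun y ↦ T.g y (B.F k y) (Y y)) x).smulRight (B.F k x))
    + (dfn n (fun y ↦ T.lam y (Y y)) x).smulRight (T.reeb x)

theorem flat_apply (Y : Π x : M, Tan n x) (x : M) (v : Tan n x) :
    B.flat Y x v = ∑ k, (dfn n (fun y ↦ T.g y (B.E k y) (Y y)) x v • B.E k x
      + dfn n (fun y ↦ T.g y (B.F k y) (Y y)) x v • B.F k x)
    + dfn n (fun y ↦ T.lam y (Y y)) x v • T.reeb x := by
  simp [flat, sum_apply]

variable {B} {x : M} (hx : x ∈ B.U)
include hx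

theorem diff_g_E (k : Fin n) {Y : Π x : M, Tan n x} (hY : DiffAt Y x) :
    DiffFnAt n (fun y ↦ T.g y (B.E k y) (Y y)) x := T.diff_g (B.smoothAt_E k hx).diffAt hY

theorem diff_g_F (k : Fin n) {Y : Π x : M, Tan n x} (hY : DiffAt Y x) :
    DiffFnAt n (fun y ↦ T.g y (B.F k y) (Y y)) x := T.diff_g (B.smoothAt_F k hx).diffAt hY

theorem flat_add {Y Z : Π x : M, Tan n x} (hY : DiffAt Y x) (hZ : DiffAt Z x) :
    B.flat (Y + Z) x = B.flat Y x + B.flat Z x := by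
  ext1 v
  rw [add_apply, flat_apply, flat_apply, flat_apply]
  simp only [Pi.add_apply, map_add]
  rw [dfn_add (T.diff_lam_apply hY) (T.diff_lam_apply hZ)]
  simp only [dfn_add (diff_g_E hx _ hY) (diff_g_E hx _ hZ),
    dfn_add (diff_g_F hx _ hY) (diff_g_F hx _ hZ), add_smul, Finset.sum_add_distrib]
  abel

theorem flat_leibniz {Y : Π x : M, Tan n x} {f : M → ℝ} (hY : DiffAt Y x) (hf : DiffFnAt n f x) :
    B.flat (f • Y) x = f x • B.flat Y x + (dfn n f x).smulRight (Y x) := by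
  ext1 v
  rw [add_apply, smul_apply, ContinuousLinearMap.smulRight_apply, flat_apply, flat_apply]
  conv_rhs => rw [B.expand hx (Y x)]
  simp only [Pi.smul_apply', map_smul, smul_eq_mul]
  rw [dfn_mul hf (T.diff_lam_apply hY)]
  simp only [dfn_mul hf (diff_g_E hx _ hY), dfn_mul hf (diff_g_F hx _ hY), add_smul,
    Finset.sum_add_distrib, smul_add, Finset.smul_sum, smul_smul]
  simp only [mul_comm]
  abel

theorem flat_smoothAt {Y V : Π x : M, Tan n x} (hY : SmoothAt Y x) (hV : SmoothAt V x) :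
    SmoothAt (fun y ↦ B.flat Y y (V y)) x := by
  simp only [flat_apply]
  exact (SmoothAt.sum fun k _ ↦ (SmoothAt.smul (SmoothAt.dfn (T.smooth_g (B.smoothAt_E k hx) hY) hV)
    (B.smoothAt_E k hx)).add (SmoothAt.smul (SmoothAt.dfn (T.smooth_g (B.smoothAt_F k hx) hY) hV)
    (B.smoothAt_F k hx))).add (SmoothAt.smul (SmoothAt.dfn (T.smooth_lam_apply hY) hV)
    (T.smoothAt_reeb x))

theorem flat_metric {Y Z : Π x : M, Tan n x} (hY : DiffAt Y x) (hZ : DiffAt Z x) (v : Tan n x) :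
    dfn n (fun y ↦ T.g y (Y y) (Z y)) x v
      = T.g x (B.flat Y x v) (Z x) + T.g x (Y x) (B.flat Z x v) := by
  have e : ∀ᶠ y in 𝓝 x, T.g y (Y y) (Z y) = ∑ k, (T.g y (B.E k y) (Y y) * T.g y (B.E k y) (Z y)
      + T.g y (B.F k y) (Y y) * T.g y (B.F k y) (Z y)) + T.lam y (Y y) * T.lam y (Z y) := by
    filter_upwards [B.isOpen.mem_nhds hx] with y hy
    exact B.g_eq_sum hy _ _
  have hE := fun k ↦ diff_g_E hx k hY
  have hE' := fun k ↦ diff_g_E hx k hZ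
  have hF := fun k ↦ diff_g_F hx k hY
  have hF' := fun k ↦ diff_g_F hx k hZ
  have d1 : ∀ k, DiffFnAt n (fun y ↦ T.g y (B.E k y) (Y y) * T.g y (B.E k y) (Z y)) x :=
    fun k ↦ (hE k).mul (hE' k)
  have d2 : ∀ k, DiffFnAt n (fun y ↦ T.g y (B.F k y) (Y y) * T.g y (B.F k y) (Z y)) x :=
    fun k ↦ (hF k).mul (hF' k)
  have d3 : ∀ k, DiffFnAt n (fun y ↦ T.g y (B.E k y) (Y y) * T.g y (B.E k y) (Z y)
      + T.g y (B.F k y) (Y y) * T.g y (B.F k y) (Z y)) x := fun k ↦ (d1 k).add (d2 k)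
  have d4 : DiffFnAt n (fun y ↦ T.lam y (Y y) * T.lam y (Z y)) x :=
    (T.diff_lam_apply hY).mul (T.diff_lam_apply hZ)
  have hg : ∀ (W : Π x : M, Tan n x) (w : Tan n x), T.g x w (B.flat W x v) =
      ∑ k, (dfn n (fun y ↦ T.g y (B.E k y) (W y)) x v * T.g x (B.E k x) w
        + dfn n (fun y ↦ T.g y (B.F k y) (W y)) x v * T.g x (B.F k x) w)
      + dfn n (fun y ↦ T.lam y (W y)) x v * T.lam x w := by
    intro W w
    rw [flat_apply, T.g_symm]
    simp [T.g_reeb_left]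
  have hsum : ∑ k, dfn n (fun y ↦ T.g y (B.E k y) (Y y) * T.g y (B.E k y) (Z y)
      + T.g y (B.F k y) (Y y) * T.g y (B.F k y) (Z y)) x v =
      ∑ k, (dfn n (fun y ↦ T.g y (B.E k y) (Y y)) x v * T.g x (B.E k x) (Z x)
        + dfn n (fun y ↦ T.g y (B.F k y) (Y y)) x v * T.g x (B.F k x) (Z x))
      + ∑ k, (dfn n (fun y ↦ T.g y (B.E k y) (Z y)) x v * T.g x (B.E k x) (Y x)
        + dfn n (fun y ↦ T.g y (B.F k y) (Z y)) x v * T.g x (B.F k x) (Y x)) := by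
    rw [← Finset.sum_add_distrib]
    refine Finset.sum_congr rfl fun k _ ↦ ?_
    rw [dfn_add (d1 k) (d2 k), dfn_mul (hE k) (hE' k), dfn_mul (hF k) (hF' k)]
    ring
  rw [dfn_congr e, dfn_add (diffFnAt_sum fun k _ ↦ d3 k) d4, dfn_sum fun k _ ↦ d3 k,
    dfn_mul (T.diff_lam_apply hY) (T.diff_lam_apply hZ), T.g_symm x (B.flat Y x v), hg, hg, hsum]
  ring

theorem flat_J {Y : Π x : M, Tan n x} (v : Tan n x) :
    B.flat (fun y ↦ T.J y (Y y)) x v = T.J x (B.flat Y x v) := by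
  have e1 : ∀ k y, T.g y (B.E k y) (T.J y (Y y)) = -T.g y (B.F k y) (Y y) := fun k y ↦ by
    rw [F, T.g_J_left, neg_neg]
  have e2 : ∀ k, ∀ᶠ y in 𝓝 x, T.g y (B.F k y) (T.J y (Y y)) = T.g y (B.E k y) (Y y) := by
    intro k
    filter_upwards [B.isOpen.mem_nhds hx] with y hy
    rw [F, T.g_J_J, T.proj_of_lam_eq_zero (B.lam_E k hy)]
  rw [flat_apply, flat_apply]
  simp only [e1, dfn_congr (e2 _), dfn_neg, T.lam_J, dfn_const, map_add, map_sum, map_smul,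
    B.J_E, B.J_F _ hx, T.J_reeb', smul_zero, add_zero, zero_apply, zero_smul, smul_neg, neg_smul]
  exact Finset.sum_congr rfl fun k _ ↦ add_comm _ _

theorem flat_reeb (v : Tan n x) : B.flat T.reeb x v = 0 := by
  have e1 : ∀ k, ∀ᶠ y in 𝓝 x, T.g y (B.E k y) (T.reeb y) = 0 := by
    intro k
    filter_upwards [B.isOpen.mem_nhds hx] with y hy
    rw [T.g_reeb_right, B.lam_E k hy]
  rw [flat_apply]
  simp only [dfn_congr (e1 _)]
  simp [T.g_reeb_right, B.lam_F, T.lam_reeb, dfn_const]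

end Frame

/-- A smooth affine connection for which `g`, `J` and `R` are parallel. -/
structure IsUnitary (T : ContactTriad n M) (D : AffineConnection n M) : Prop where
  smooth : ∀ {Y V : Π x : M, Tan n x} {x : M}, SmoothAt Y x → SmoothAt V x →
    SmoothAt (fun y ↦ D Y y (V y)) x
  metric : ∀ {Y Z : Π x : M, Tan n x} {x : M} (v : Tan n x), DiffAt Y x → DiffAt Z x →
    dfn n (fun y ↦ T.g y (Y y) (Z y)) x v = T.g x (D Y x v) (Z x) + T.g x (Y x) (D Z x v)
  J : ∀ {Y : Π x : M, Tan n x} {x : M} (v : Tan n x), DiffAt Y x →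
    D (fun y ↦ T.J y (Y y)) x v = T.J x (D Y x v)
  reeb : ∀ (x : M) (v : Tan n x), D T.reeb x v = 0

/-- Gluing the flat connections of local frames by a partition of unity. -/
theorem exists_isUnitary [T2Space M] [SigmaCompactSpace M] (T : ContactTriad n M) :
    ∃ D : AffineConnection n M, T.IsUnitary D := by
  choose B hB using T.exists_frame
  obtain ⟨ρ, hρ⟩ := SmoothPartitionOfUnity.exists_isSubordinate (𝓡 (2 * n + 1))
    (isClosed_univ (X := M)) (fun x ↦ (B x).U) (fun x ↦ (B x).isOpen)
    (fun x _ ↦ Set.mem_iUnion.2 ⟨x, hB x⟩)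
  have hU : ∀ {x : M} {i : M}, i ∈ ρ.finsupport x → x ∈ (B i).U := fun {x i} hi ↦
    hρ i (subset_tsupport _ ((ρ.mem_finsupport x).1 hi))
  have hsum : ∀ x, ∑ i ∈ ρ.finsupport x, ρ i x = 1 := fun x ↦ ρ.sum_finsupport x (Set.mem_univ x)
  -- A convex combination of connections: only the Leibniz rule and the metric condition need the
  -- weights to sum to 1, the other properties pass to any linear combination.
  let D : AffineConnection n M :=
    { toFun := fun Y x ↦ ∑ i ∈ ρ.finsupport x, ρ i x • (B i).flat Y x
      isCovariantDerivativeOnUniv :=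
        { add := by
            intro Y Z x hY hZ _
            rw [← Finset.sum_add_distrib]
            refine Finset.sum_congr rfl fun i hi ↦ ?_
            rw [Frame.flat_add (hU hi) hY hZ, smul_add]
          leibniz := by
            intro Y f x hY hf _
            have : ∀ i ∈ ρ.finsupport x, ρ i x • (B i).flat (f • Y) x =
                f x • ρ i x • (B i).flat Y x + ρ i x • (dfn n f x).smulRight (Y x) := by
              intro i hi
              rw [Frame.flat_leibniz (hU hi) hY hf, smul_add, smul_comm]
            rw [Finset.sum_congr rfl this, Finset.sum_add_distrib, ← Finset.smul_sum,
              ← Finset.sum_smul, hsum, one_smul] } }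
  have hD : ∀ Y x v, D Y x v = ∑ i ∈ ρ.finsupport x, ρ i x • (B i).flat Y x v := by
    intro Y x v
    simp [D, sum_apply]
  refine ⟨D, ⟨fun {Y V x} hY hV ↦ ?_, fun {Y Z x} v hY hZ ↦ ?_, fun {Y x} v hY ↦ ?_,
    fun x v ↦ ?_⟩⟩
  -- The index set `ρ.finsupport y` varies with `y`; a locally finite sum over all indices has terms
  -- whose smoothness can be checked one by one. Each flat connection is controlled only on its own
  -- domain, but outside the support of its weight the term is locally zero.
  · have e : (fun y ↦ D Y y (V y)) = fun y ↦ ∑ᶠ i, ρ i y • (B i).flat Y y (V y) := by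
      ext1 y
      rw [hD]
      exact ρ.sum_finsupport_smul_eq_finsum (φ := fun i y ↦ (B i).flat Y y (V y)) y
    rw [e]
    refine ContMDiffAt.finsum_section_of_locallyFinite
      (t := fun i y ↦ ρ i y • (B i).flat Y y (V y)) ?_ fun i ↦ ?_
    · refine ρ.locallyFinite.subset fun i y hy ↦ ?_
      simp only [Set.mem_ofPred_eq] at hy
      exact fun h ↦ hy (by rw [h, zero_smul])
    · by_cases hx : x ∈ tsupport (ρ i)
      · exact SmoothAt.smul ((ρ i).contMDiff x) (Frame.flat_smoothAt (hρ i hx) hY hV)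
      · refine SmoothAt.congr (SmoothAt.zero x) ?_
        filter_upwards [(isClosed_tsupport (ρ i)).isOpen_compl.mem_nhds hx] with y hy
        rw [image_eq_zero_of_notMem_tsupport hy, zero_smul]
  · have : ∀ i ∈ ρ.finsupport x, ρ i x * dfn n (fun y ↦ T.g y (Y y) (Z y)) x v =
        T.g x (ρ i x • (B i).flat Y x v) (Z x) + T.g x (Y x) (ρ i x • (B i).flat Z x v) := by
      intro i hi
      rw [Frame.flat_metric (hU hi) hY hZ]
      simp [mul_add]
    rw [hD, hD, map_sum, map_sum, LinearMap.sum_apply, ← Finset.sum_add_distrib,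
      ← Finset.sum_congr rfl this, ← Finset.sum_mul, hsum, one_mul]
  · rw [hD, hD, map_sum]
    refine Finset.sum_congr rfl fun i hi ↦ ?_
    rw [Frame.flat_J (hU hi), map_smul]
  · rw [hD]
    refine Finset.sum_eq_zero fun i hi ↦ ?_
    rw [Frame.flat_reeb (hU hi), smul_zero]

end ContactTriad

/-! ### The correction tensor and existence. -/

namespace ContactTriad

variable {n : ℕ} {M : Type*} [TopologicalSpace M] [ChartedSpace (ModelE n) M]
  [IsManifold (𝓡 (2 * n + 1)) ∞ M]

theorem g_add_left (T : ContactTriad n M) (x : M) (u v w : Tan n x) :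
    T.g x (u + v) w = T.g x u w + T.g x v w := by simp

theorem g_sub_left (T : ContactTriad n M) (x : M) (u v w : Tan n x) :
    T.g x (u - v) w = T.g x u w - T.g x v w := by simp

theorem g_smul_left (T : ContactTriad n M) (x : M) (a : ℝ) (v w : Tan n x) :
    T.g x (a • v) w = a * T.g x v w := by simp

theorem g_neg_left (T : ContactTriad n M) (x : M) (v w : Tan n x) :
    T.g x (-v) w = -T.g x v w := by simp

namespace Frame

variable {T : ContactTriad n M} (B : T.Frame)

/-- The `g`-transpose of a linear map that kills the Reeb field, computed in a frame. -/
def transpose {x : M} (L : Tan n x →ₗ[ℝ] Tan n x) (w : Tan n x) : Tan n x :=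
  ∑ k, (T.g x w (L (B.E k x)) • B.E k x + T.g x w (L (B.F k x)) • B.F k x)

theorem g_transpose {x : M} (hx : x ∈ B.U) {L : Tan n x →ₗ[ℝ] Tan n x} (hL : L (T.reeb x) = 0)
    (w z : Tan n x) : T.g x (B.transpose L w) z = T.g x w (L z) := by
  conv_rhs => rw [B.expand hx z]
  simp only [transpose, map_add, map_sum, map_smul, LinearMap.add_apply, LinearMap.sum_apply,
    LinearMap.smul_apply, hL, smul_zero, add_zero, smul_eq_mul]
  simp only [mul_comm]

end Frame

variable (T : ContactTriad n M)

section Correction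

variable {x : M} (c : ℝ) (τ : Tan n x →L[ℝ] Tan n x →L[ℝ] Tan n x)

/-- The covariant derivative of the Reeb field for the connection to be constructed, in terms of
the torsion of a unitary connection. -/
def reebPart : Tan n x →ₗ[ℝ] Tan n x :=
  (-(c / 2)) • (T.J x : Tan n x →ₗ[ℝ] Tan n x) + (1 / 2 : ℝ) •
    ((T.J x : Tan n x →ₗ[ℝ] Tan n x) ∘ₗ (τ (T.reeb x) : Tan n x →ₗ[ℝ] Tan n x) ∘ₗ
      (T.J x : Tan n x →ₗ[ℝ] Tan n x) + (τ (T.reeb x) : Tan n x →ₗ[ℝ] Tan n x))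

theorem reebPart_apply (v : Tan n x) : T.reebPart c τ v =
    (-(c / 2)) • T.J x v + (1 / 2 : ℝ) • (T.J x (τ (T.reeb x) (T.J x v)) + τ (T.reeb x) v) := rfl

/-- The part of the correction term that is antilinear in the direction. -/
def antilinearPart : Tan n x →ₗ[ℝ] Tan n x →ₗ[ℝ] Tan n x :=
  LinearMap.mk₂ ℝ (fun v w ↦ (-(1 / 4 : ℝ)) • T.proj x (τ (T.proj x v) (T.proj x w)
      + τ (T.J x v) (T.J x w) + T.J x (τ (T.J x v) (T.proj x w))
      - T.J x (τ (T.proj x v) (T.J x w))))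
    (by intros; simp only [map_add, proj_add, proj_sub, add_apply]; module)
    (by intros; simp only [map_smul, proj_smul, proj_add, proj_sub, smul_apply]; module)
    (by intros; simp only [map_add, proj_add, proj_sub]; module)
    (by intros; simp only [map_smul, proj_smul, proj_add, proj_sub]; module)

theorem antilinearPart_apply (v w : Tan n x) : T.antilinearPart τ v w =
    (-(1 / 4 : ℝ)) • T.proj x (τ (T.proj x v) (T.proj x w)
      + τ (T.J x v) (T.J x w) + T.J x (τ (T.J x v) (T.proj x w))
      - T.J x (τ (T.proj x v) (T.J x w))) := rfl

theorem lam_antilinearPart (v w : Tan n x) : T.lam x (T.antilinearPart τ v w) = 0 := by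
  rw [antilinearPart_apply, map_smul, lam_proj, smul_zero]

theorem antilinearPart_reeb_left (w : Tan n x) : T.antilinearPart τ (T.reeb x) w = 0 := by
  simp [antilinearPart_apply, proj_reeb, J_reeb', proj_zero]

theorem antilinearPart_reeb_right (v : Tan n x) : T.antilinearPart τ v (T.reeb x) = 0 := by
  simp [antilinearPart_apply, proj_reeb, J_reeb', proj_zero]

/-- On `ξ` the four terms are minus the projection of `πτ` to the maps antilinear in `v` and linear
in `w`, that is, the product of the projections `(τ(v, ·) + Jτ(Jv, ·))/2` and `(τ(·, w) - Jτ(·,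
Jw))/2`. This identity and the next express the two symmetries. -/
theorem antilinearPart_J_right (v w : Tan n x) :
    T.antilinearPart τ v (T.J x w) = T.J x (T.antilinearPart τ v w) := by
  simp only [antilinearPart_apply, map_smul, proj_J, J_J, proj_add, proj_sub, map_add, map_sub,
    map_neg, J_proj, proj_neg]
  module

theorem antilinearPart_J_left (v w : Tan n x) :
    T.antilinearPart τ (T.J x v) w = -T.J x (T.antilinearPart τ v w) := by
  simp only [antilinearPart_apply, map_smul, proj_J, J_J, proj_add, proj_sub, map_add, map_sub,
    map_neg, J_proj, proj_neg, neg_apply]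
  module

/-- The correction term as a function. -/
def correctionFun (v w : Tan n x) : Tan n x :=
  T.antilinearPart τ v w - (T.exists_frame x).choose.transpose (T.antilinearPart τ v) w
    - T.g x (T.reebPart c τ v) w • T.reeb x + T.lam x w • T.reebPart c τ v
    + T.lam x v • (T.reebPart c τ w - τ (T.reeb x) w)

theorem g_transpose_antilinearPart (v w z : Tan n x) :
    T.g x ((T.exists_frame x).choose.transpose (T.antilinearPart τ v) w) z =
      T.g x w (T.antilinearPart τ v z) :=
  Frame.g_transpose _ (T.exists_frame x).choose_spec (T.antilinearPart_reeb_right τ v) w z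

/-- Pairing with `z` eliminates the chosen frame, since a transpose is determined by `g`. All
properties of the correction are checked in this form. -/
theorem g_correctionFun (v w z : Tan n x) : T.g x (T.correctionFun c τ v w) z =
    T.g x (T.antilinearPart τ v w) z - T.g x w (T.antilinearPart τ v z)
      - T.g x (T.reebPart c τ v) w * T.lam x z + T.lam x w * T.g x (T.reebPart c τ v) z
      + T.lam x v * (T.g x (T.reebPart c τ w) z - T.g x (τ (T.reeb x) w) z) := by
  simp only [correctionFun, g_add_left, g_sub_left, g_smul_left, g_transpose_antilinearPart,
    g_reeb_left]

/-- The tensor which corrects a unitary connection with torsion `τ`; the second argument is the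
direction of differentiation. -/
def correction : Tan n x →L[ℝ] Tan n x →L[ℝ] Tan n x :=
  haveI : FiniteDimensional ℝ (Tan n x) := finiteDimensional_tan n x
  haveI : T2Space (Tan n x) := inferInstanceAs (T2Space (ModelE n))
  LinearMap.toContinuousLinearMap
    ((LinearMap.toContinuousLinearMap : (Tan n x →ₗ[ℝ] Tan n x) ≃ₗ[ℝ] _).toLinearMap ∘ₗ
      LinearMap.mk₂ ℝ (fun w v ↦ T.correctionFun c τ v w)
        (fun w w' v ↦ T.eq_of_forall_g fun z ↦ by
          simp only [g_correctionFun, map_add, LinearMap.add_apply]; ring)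
        (fun a w v ↦ T.eq_of_forall_g fun z ↦ by
          simp only [g_correctionFun, map_smul, LinearMap.smul_apply, smul_eq_mul]
          ring)
        (fun w v v' ↦ T.eq_of_forall_g fun z ↦ by
          simp only [g_correctionFun, map_add, LinearMap.add_apply]; ring)
        (fun a w v ↦ T.eq_of_forall_g fun z ↦ by
          simp only [g_correctionFun, map_smul, LinearMap.smul_apply, smul_eq_mul]
          ring))

theorem correction_apply (v w : Tan n x) : T.correction c τ w v = T.correctionFun c τ v w := rfl

end Correction

namespace IsUnitary

variable {T} {D : AffineConnection n M} (h : T.IsUnitary D)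
include h

theorem lam_apply {Y : Π x : M, Tan n x} {x : M} (v : Tan n x) (hY : DiffAt Y x) :
    T.lam x (D Y x v) = dfn n (fun y ↦ T.lam y (Y y)) x v := by
  have := h.metric v (T.smoothAt_reeb x).diffAt hY
  rw [h.reeb, map_zero, LinearMap.zero_apply, zero_add, g_reeb_left] at this
  rw [← this]
  simp only [g_reeb_left]

theorem dlam_parallel {Y Z : Π x : M, Tan n x} {x : M} (v : Tan n x) (hY : DiffAt Y x)
    (hZ : DiffAt Z x) : dfn n (fun y ↦ T.dlam y (Y y) (Z y)) x v =
      T.dlam x (D Y x v) (Z x) + T.dlam x (Y x) (D Z x v) := by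
  simp only [← g_J_left_eq_dlam]
  rw [h.metric v (T.diffAt_J hY) hZ, h.J v hY]

/-- This is `d(dλ) = 0` for a connection that preserves `dλ`: the derivative terms cancel and
brackets are exchanged for torsion. -/
theorem cyclic_torsion {x : M} (u v w : Tan n x) : T.dlam x (D.torsion x u v) w
    + T.dlam x (D.torsion x v w) u + T.dlam x (D.torsion x w u) v = 0 := by
  obtain ⟨X, hX, rfl⟩ := exists_smoothAt_extend u
  obtain ⟨Y, hY, rfl⟩ := exists_smoothAt_extend v
  obtain ⟨Z, hZ, rfl⟩ := exists_smoothAt_extend w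
  rw [D.torsion_apply hX.diffAt hY.diffAt, D.torsion_apply hY.diffAt hZ.diffAt,
    D.torsion_apply hZ.diffAt hX.diffAt]
  have := T.cyclic_dlam hX hY hZ
  rw [h.dlam_parallel _ hY.diffAt hZ.diffAt, h.dlam_parallel _ hZ.diffAt hX.diffAt,
    h.dlam_parallel _ hX.diffAt hY.diffAt] at this
  simp only [map_sub, sub_apply]
  rw [T.dlam_swap x (Y x) (D Z x (X x)), T.dlam_swap x (Z x) (D X x (Y x)),
    T.dlam_swap x (X x) (D Y x (Z x))] at this
  linarith

theorem lam_torsion {x : M} (v w : Tan n x) : T.lam x (D.torsion x v w) = T.dlam x v w := by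
  obtain ⟨X, hX, rfl⟩ := exists_smoothAt_extend v
  obtain ⟨Y, hY, rfl⟩ := exists_smoothAt_extend w
  rw [D.torsion_apply hX.diffAt hY.diffAt, T.dlam_eq_cartanExpr hX.diffAt hY.diffAt, map_sub,
    map_sub, h.lam_apply _ hX.diffAt, h.lam_apply _ hY.diffAt]
  rfl

theorem lam_torsion_reeb {x : M} (w : Tan n x) : T.lam x (D.torsion x (T.reeb x) w) = 0 := by
  rw [h.lam_torsion, dlam_reeb_left]

/-- With `t = τ(R, ·)`: `JtJ` is the `g`-transpose of `t`. It is the cyclic identity for `R`, `Jv`,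
`w`, whose middle term vanishes because `dλ(·, R) = 0`. -/
theorem J_torsion_reeb {x : M} (v w : Tan n x) : T.g x (T.J x (D.torsion x (T.reeb x) (T.J x v))) w
    = T.g x v (D.torsion x (T.reeb x) w) := by
  have := h.cyclic_torsion (T.reeb x) (T.J x v) w
  rw [dlam_reeb_right, D.torsion_antisymm w, map_neg, neg_apply,
    T.dlam_swap x _ (T.J x v), ← g_J_left_eq_dlam, ← g_J_left_eq_dlam, J_J, g_neg_left,
    T.g_proj_left_of_lam _ (h.lam_torsion_reeb w)] at this
  linarith

variable (c : ℝ)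

theorem lam_reebPart {x : M} (v : Tan n x) : T.lam x (T.reebPart c (D.torsion x) v) = 0 := by
  simp [reebPart_apply, lam_J, h.lam_torsion_reeb]

/-- By `J_torsion_reeb`, `A = -(c/2) J + (t + t^T)/2`; so `A - t = -(c/2) J + (t^T - t)/2`, which is
skew. -/
theorem skew {x : M} (w z : Tan n x) :
    T.g x (T.reebPart c (D.torsion x) w) z - T.g x (D.torsion x (T.reeb x) w) z
      = -(T.g x w (T.reebPart c (D.torsion x) z) - T.g x w (D.torsion x (T.reeb x) z)) := by
  rw [T.g_symm x w (T.reebPart _ _ z)]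
  simp only [reebPart_apply, g_add_left, g_smul_left, h.J_torsion_reeb]
  rw [T.g_J_left x w z, T.g_symm x w (T.J x z), T.g_symm x z, T.g_symm x w]
  ring

omit h in
theorem reebPart_reeb {x : M} : T.reebPart c (D.torsion x) (T.reeb x) = 0 := by
  simp [reebPart_apply, J_reeb']

/-- Skewness in `w, z` is equivalent to preserving `g`. The terms are skew in groups: `Q_v - Q_v^T`,
then `λ(·) Av - g(Av, ·) R`, then `A - t`. -/
theorem correction_skew {x : M} (v w z : Tan n x) :
    T.g x (T.correction c (D.torsion x) w v) z + T.g x w (T.correction c (D.torsion x) z v) = 0 := by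
  rw [T.g_symm x w, correction_apply, correction_apply, g_correctionFun, g_correctionFun,
    h.skew, T.g_symm x z, T.g_symm x w (T.reebPart _ _ z), T.g_symm x (T.antilinearPart _ _ z) w,
    T.g_symm x w (D.torsion x _ z)]
  ring

theorem correction_reeb {x : M} (v : Tan n x) :
    T.correction c (D.torsion x) (T.reeb x) v = T.reebPart c (D.torsion x) v := by
  refine T.eq_of_forall_g fun z ↦ ?_
  rw [correction_apply, g_correctionFun]
  simp [antilinearPart_reeb_right, g_reeb_left, g_reeb_right, lam_antilinearPart,
    h.lam_reebPart, lam_reeb, reebPart_reeb]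

-- The value in direction `R` is chosen to cancel the Reeb torsion: the new `T(R, w)` is `tw + S_R w
-- - Aw`.
omit h in
theorem correction_reeb_direction {x : M} (w : Tan n x) :
    T.correction c (D.torsion x) w (T.reeb x) =
      T.reebPart c (D.torsion x) w - D.torsion x (T.reeb x) w := by
  refine T.eq_of_forall_g fun z ↦ ?_
  rw [correction_apply, g_correctionFun]
  simp [antilinearPart_reeb_left, lam_reeb, reebPart_reeb]

/-- On `ξ`, `t + JtJ` anticommutes with `J`, while `-(c/2) J` contributes `-c J² = c`. -/
theorem reebPart_J {x : M} {v : Tan n x} (hv : T.lam x v = 0) :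
    T.reebPart c (D.torsion x) (T.J x v) + T.J x (T.reebPart c (D.torsion x) v) = c • v := by
  have e : T.proj x (D.torsion x (T.reeb x) (T.J x v)) = D.torsion x (T.reeb x) (T.J x v) :=
    T.proj_of_lam_eq_zero (h.lam_torsion_reeb _)
  simp only [reebPart_apply, J_J, T.proj_of_lam_eq_zero hv, map_add, map_smul, map_neg, e]
  module

/-- Here `A - t = -(c/2) J + (JtJ - t)/2`, and `JtJ - t` commutes with `J` on `ξ`. -/
theorem reebPart_sub_J {x : M} {v : Tan n x} (hv : T.lam x v = 0) :
    T.reebPart c (D.torsion x) (T.J x v) - D.torsion x (T.reeb x) (T.J x v) =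
      T.J x (T.reebPart c (D.torsion x) v - D.torsion x (T.reeb x) v) := by
  have e : T.proj x (D.torsion x (T.reeb x) (T.J x v)) = D.torsion x (T.reeb x) (T.J x v) :=
    T.proj_of_lam_eq_zero (h.lam_torsion_reeb _)
  simp only [reebPart_apply, J_J, T.proj_of_lam_eq_zero hv, map_add, map_sub, map_smul, map_neg, e]
  module

theorem correction_J {x : M} {w : Tan n x} (hw : T.lam x w = 0) (v : Tan n x) :
    T.proj x (T.correction c (D.torsion x) (T.J x w) v) =
      T.J x (T.correction c (D.torsion x) w v) := by
  refine T.eq_of_forall_g_xi (T.lam_proj x _) (T.lam_J x _) fun z hz ↦ ?_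
  rw [T.g_proj_left_of_lam _ hz, g_J_left, correction_apply, correction_apply, g_correctionFun,
    g_correctionFun, lam_J, lam_J, hw, hz, antilinearPart_J_right, antilinearPart_J_right,
    g_J_left, g_J_left]
  have e := congrArg (T.g x) (h.reebPart_sub_J c hw)
  have e' := LinearMap.congr_fun e z
  rw [g_sub_left, g_J_left, g_sub_left] at e'
  rw [e']
  ring

-- `Q^T` is complex bilinear on `ξ`, so its contributions at `(Jw, w)` and `(w, Jw)` cancel. `Q`
-- contributes `-2JQ(w, w)`, which is `-πτ(Jw, w)` because of the coefficient `-1/4` in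
-- `antilinearPart`.
omit h in
theorem correction_torsion {x : M} {w : Tan n x} (hw : T.lam x w = 0) :
    T.proj x (D.torsion x (T.J x w) w + T.correction c (D.torsion x) w (T.J x w)
      - T.correction c (D.torsion x) (T.J x w) w) = 0 := by
  refine T.eq_of_forall_g_xi (T.lam_proj x _) (map_zero _) fun z hz ↦ ?_
  have hQ : T.antilinearPart (D.torsion x) w w =
      (-(1 / 2 : ℝ)) • T.J x (D.torsion x (T.J x w) w) := by
    rw [antilinearPart_apply, T.proj_of_lam_eq_zero hw, D.torsion_self, D.torsion_self,
      D.torsion_antisymm w (T.J x w), map_neg, sub_neg_eq_add, zero_add, zero_add, proj_add, proj_J]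
    module
  have e₁ : T.g x (T.correctionFun c (D.torsion x) (T.J x w) w) z =
      -T.g x (T.J x (T.antilinearPart (D.torsion x) w w)) z
        + T.g x w (T.J x (T.antilinearPart (D.torsion x) w z)) := by
    rw [g_correctionFun, lam_J, hw, hz, antilinearPart_J_left, antilinearPart_J_left, g_neg_left,
      map_neg]
    ring
  have e₂ : T.g x (T.correctionFun c (D.torsion x) w (T.J x w)) z =
      T.g x (T.J x (T.antilinearPart (D.torsion x) w w)) z
        - T.g x (T.J x w) (T.antilinearPart (D.torsion x) w z) := by
    rw [g_correctionFun, lam_J, hw, hz, antilinearPart_J_right]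
    ring
  have e₃ : T.g x (T.J x (T.antilinearPart (D.torsion x) w w)) z =
      (1 / 2) * T.g x (D.torsion x (T.J x w) w) z := by
    rw [hQ, map_smul, J_J, g_smul_left, g_neg_left, T.g_proj_left_of_lam _ hz]
    ring
  rw [T.g_proj_left_of_lam _ hz, g_sub_left, g_add_left, correction_apply, correction_apply,
    e₁, e₂, e₃, T.g_J_left x w, map_zero, LinearMap.zero_apply]
  ring

theorem smoothAt_torsion {V W : Π x : M, Tan n x} {x : M} (hV : SmoothAt V x) (hW : SmoothAt W x) :
    SmoothAt (fun y ↦ D.torsion y (V y) (W y)) x := by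
  refine (((h.smooth hW hV).sub (h.smooth hV hW)).sub (hV.bracket hW)).congr ?_
  filter_upwards [hV.eventually_diffAt, hW.eventually_diffAt] with y h1 h2
  exact D.torsion_apply h1 h2

theorem smoothAt_reebPart {V : Π x : M, Tan n x} {x : M} (hV : SmoothAt V x) :
    SmoothAt (fun y ↦ T.reebPart c (D.torsion y) (V y)) x := by
  simp only [reebPart_apply]
  exact ((T.smoothAt_J hV).const_smul _).add (((T.smoothAt_J (h.smoothAt_torsion
    (T.smoothAt_reeb x) (T.smoothAt_J hV))).add
      (h.smoothAt_torsion (T.smoothAt_reeb x) hV)).const_smul _)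

theorem smoothAt_antilinearPart {V W : Π x : M, Tan n x} {x : M} (hV : SmoothAt V x)
    (hW : SmoothAt W x) :
    SmoothAt (fun y ↦ T.antilinearPart (D.torsion y) (V y) (W y)) x := by
  simp only [antilinearPart_apply]
  have pV := T.smoothAt_proj hV
  have pW := T.smoothAt_proj hW
  have jV := T.smoothAt_J hV
  have jW := T.smoothAt_J hW
  exact (T.smoothAt_proj ((((h.smoothAt_torsion pV pW).add (h.smoothAt_torsion jV jW)).add
    (T.smoothAt_J (h.smoothAt_torsion jV pW))).sub
      (T.smoothAt_J (h.smoothAt_torsion pV jW)))).const_smul _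

/-- The correction term maps smooth fields to smooth fields. -/
theorem smoothAt_correction {V W : Π x : M, Tan n x} {x : M} (hV : SmoothAt V x)
    (hW : SmoothAt W x) :
    SmoothAt (fun y ↦ T.correction c (D.torsion y) (W y) (V y)) x := by
  obtain ⟨B, hx⟩ := T.exists_frame x
  have hE := fun k ↦ B.smoothAt_E k hx
  have hF := fun k ↦ B.smoothAt_F k hx
  have hA := h.smoothAt_reebPart c hV
  -- The frame is chosen separately at each `y`, with no continuity, but the transpose does not
  -- depend on it; near `x` the single frame `B` computes it.
  have htr : SmoothAt (fun y ↦ (T.exists_frame y).choose.transpose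
      (T.antilinearPart (D.torsion y) (V y)) (W y)) x := by
    have : SmoothAt (fun y ↦ B.transpose (T.antilinearPart (D.torsion y) (V y)) (W y)) x :=
      SmoothAt.sum fun k _ ↦
        (SmoothAt.smul (T.smooth_g hW (h.smoothAt_antilinearPart hV (hE k))) (hE k)).add
        (SmoothAt.smul (T.smooth_g hW (h.smoothAt_antilinearPart hV (hF k))) (hF k))
    refine this.congr ?_
    filter_upwards [B.isOpen.mem_nhds hx] with y hy
    refine T.eq_of_forall_g fun z ↦ ?_
    rw [g_transpose_antilinearPart, B.g_transpose hy (T.antilinearPart_reeb_right _ _)]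
  exact ((((h.smoothAt_antilinearPart hV hW).sub htr).sub
    (SmoothAt.smul (T.smooth_g hA hW) (T.smoothAt_reeb x))).add
    (SmoothAt.smul (T.smooth_lam_apply hW) hA)).add
    (SmoothAt.smul (T.smooth_lam_apply hV)
      ((h.smoothAt_reebPart c hW).sub (h.smoothAt_torsion (T.smoothAt_reeb x) hW)))

end IsUnitary

/-- Existence of `c`-contact triad connections. -/
theorem exists_contactTriadConnection [T2Space M] [SigmaCompactSpace M] (T : ContactTriad n M)
    (c : ℝ) : ∃ D : AffineConnection n M, D.IsSmooth ∧ T.IsContactTriadConnection c D := by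
  obtain ⟨D₀, h⟩ := T.exists_isUnitary
  let D : AffineConnection n M := D₀.addOneForm fun x ↦ T.correction c (D₀.torsion x)
  have hD : ∀ Y x v, D Y x v = D₀ Y x v + T.correction c (D₀.torsion x) (Y x) v :=
    fun Y x v ↦ rfl
  have hT : ∀ (x : M) (v w : Tan n x), D.torsion x v w = D₀.torsion x v w
      + T.correction c (D₀.torsion x) w v - T.correction c (D₀.torsion x) v w := by
    intro x v w
    obtain ⟨X, hX, rfl⟩ := exists_smoothAt_extend v
    obtain ⟨Y, hY, rfl⟩ := exists_smoothAt_extend w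
    rw [D.torsion_apply hX.diffAt hY.diffAt, D₀.torsion_apply hX.diffAt hY.diffAt, hD, hD]
    abel
  have hR : ∀ (x : M) (v : Tan n x), D T.reeb x v = T.reebPart c (D₀.torsion x) v := by
    intro x v
    rw [hD, h.reeb, zero_add, h.correction_reeb]
  have hg : T.IsRiemannian D := by
    intro Y Z x v hY hZ
    change dfn n _ x v = _
    rw [h.metric v hY hZ, hD, hD, g_add_left, map_add]
    linarith [h.correction_skew c v (Y x) (Z x)]
  refine ⟨D, ⟨⟨fun {Y} hY x _ ↦ ?_⟩⟩, ⟨hg, fun x ↦ ?_, fun x v _ ↦ ?_, fun x v hv ↦ ?_,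
    fun x v ↦ ?_, fun Y Z x v hY hZ hYd hZd ↦ ⟨?_, ?_⟩, fun x v hv ↦ ?_⟩⟩
  · have hYx : SmoothAt Y x := (hY x (Set.mem_univ x)).contMDiffAt Filter.univ_mem
    refine ContMDiffAt.contMDiffWithinAt (contMDiffAt_endo_of_apply fun V hV ↦ ?_)
    exact (h.smooth hYx hV).add (h.smoothAt_correction c hV hYx)
  · rw [hR, IsUnitary.reebPart_reeb]
  · rw [hR, h.lam_reebPart]
  · rw [hR, hR, h.reebPart_J c hv]
  · rw [hT, IsUnitary.correction_reeb_direction, h.correction_reeb]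
    abel
  · rw [T.g_proj_left_of_lam _ (hZ x), T.g_proj_right_of_lam _ (hY x)]
    exact hg Y Z x v hYd hZd
  · rw [hD, hD, h.J v hYd, J_proj, proj_add, proj_J, h.correction_J c (hY x), map_add]
  · rw [hT, IsUnitary.correction_torsion c hv]

end ContactTriad

/-! ### Identities for metric and adapted connections. -/

namespace ContactTriad

variable {n : ℕ} {M : Type*} [TopologicalSpace M] [ChartedSpace (ModelE n) M]
  [IsManifold (𝓡 (2 * n + 1)) ∞ M] {T : ContactTriad n M} {D D' : AffineConnection n M}

namespace IsRiemannian

variable (h : T.IsRiemannian D)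
include h

theorem lam_cov_reeb (x : M) (v : Tan n x) : T.lam x (D T.reeb x v) = 0 := by
  have hR := (T.smoothAt_reeb x).diffAt
  have := h T.reeb T.reeb x v hR hR
  simp only [g_reeb_left, g_reeb_right, lam_reeb] at this
  have e : dfn n (fun _ : M ↦ (1 : ℝ)) x v = 0 := by rw [dfn_const]; rfl
  have e' : dfn n (fun _ : M ↦ (1 : ℝ)) x v = T.lam x (D T.reeb x v) + T.lam x (D T.reeb x v) :=
    this
  linarith

theorem lam_cov {Y : Π x : M, Tan n x} {x : M} (hY : DiffAt Y x) (v : Tan n x) :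
    T.lam x (D Y x v) = dfn n (fun y ↦ T.lam y (Y y)) x v - T.g x (D T.reeb x v) (Y x) := by
  have := h T.reeb Y x v (T.smoothAt_reeb x).diffAt hY
  simp only [g_reeb_left] at this
  exact eq_sub_of_add_eq' this.symm

theorem lam_cov_of_lam_eq_zero {Y : Π x : M, Tan n x} {x : M} (hY : DiffAt Y x)
    (hl : ∀ᶠ y in 𝓝 x, T.lam y (Y y) = 0) (v : Tan n x) :
    T.lam x (D Y x v) = -T.g x (D T.reeb x v) (Y x) := by
  have e : dfn n (fun y ↦ T.lam y (Y y)) x = 0 := by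
    rw [dfn_congr (g := fun _ ↦ (0 : ℝ)) hl, dfn_const]
  rw [h.lam_cov hY, e, zero_apply, zero_sub]

/-- Differentiating `g(R, Y) = λ(Y)` expresses `λ(∇Y)` through `∇R`; antisymmetrizing and using
Cartan's formula gives the result. -/
theorem lam_torsion {x : M} (v w : Tan n x) : T.lam x (D.torsion x v w) =
    T.dlam x v w - T.g x (D T.reeb x v) w + T.g x (D T.reeb x w) v := by
  obtain ⟨X, hX, rfl⟩ := exists_smoothAt_extend v
  obtain ⟨Y, hY, rfl⟩ := exists_smoothAt_extend w
  rw [D.torsion_apply hX.diffAt hY.diffAt, T.dlam_eq_cartanExpr hX.diffAt hY.diffAt, map_sub,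
    map_sub, h.lam_cov hX.diffAt, h.lam_cov hY.diffAt, cartanExpr]
  change _ = dfn n _ x (X x) - dfn n _ x (Y x) - _ - _ + _
  ring

end IsRiemannian

theorem IsHermitianOnXi.dlam_parallel (h : T.IsHermitianOnXi D) {Y Z : Π x : M, Tan n x} {x : M}
    (hY : DiffAt Y x) (hZ : DiffAt Z x) (lY : ∀ y, T.lam y (Y y) = 0) (lZ : ∀ y, T.lam y (Z y) = 0)
    (v : Tan n x) : dfn n (fun y ↦ T.dlam y (Y y) (Z y)) x v =
      T.dlam x (D Y x v) (Z x) + T.dlam x (Y x) (D Z x v) := by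
  simp only [← g_J_left_eq_dlam]
  have h₁ := (h (fun y ↦ T.J y (Y y)) Z x v (fun y ↦ T.lam_J y _) lZ (T.diffAt_J hY) hZ).1
  have h₂ := (h Y Z x v lY lZ hY hZ).2
  rw [h₂, J_proj, T.g_proj_right_of_lam _ (T.lam_J x _)] at h₁
  exact h₁

theorem IsContactTriadConnection.isAdapted {c : ℝ} (h : T.IsContactTriadConnection c D) :
    T.IsAdapted D :=
  ⟨h.riemannian, h.hermitian, h.reeb_torsion⟩

/-- Polarized form of the vanishing of `π T(JY, Y)`. -/
theorem proj_torsion_J_left {x : M} (h : ∀ v, T.lam x v = 0 →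
      T.proj x (D.torsion x (T.J x v) v) = 0) {v w : Tan n x}
    (hv : T.lam x v = 0) (hw : T.lam x w = 0) :
    T.proj x (D.torsion x (T.J x v) w) = T.proj x (D.torsion x v (T.J x w)) := by
  have h₁ := h (v + w) (by rw [map_add, hv, hw, add_zero])
  simp only [map_add, add_apply, proj_add, h v hv, h w hw, zero_add, add_zero] at h₁
  rw [D.torsion_antisymm v, proj_neg]
  exact eq_neg_of_add_eq_zero_right h₁

namespace IsAdapted

variable (h : T.IsAdapted D)
include h

/-- Put `R` in the first slot of `lam_torsion`: only `g(∇_R R, z)` survives. -/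
theorem cov_reeb_reeb (x : M) : D T.reeb x (T.reeb x) = 0 := by
  refine T.eq_of_forall_g fun z ↦ ?_
  have := h.riemannian.lam_torsion (T.reeb x) z
  rw [h.reeb_torsion, map_zero, dlam_reeb_left, g_reeb_right, h.riemannian.lam_cov_reeb] at this
  rw [map_zero, LinearMap.zero_apply]
  linarith

theorem bracket_reeb {Y : Π x : M, Tan n x} {x : M} (hY : DiffAt Y x) :
    mlieBracket (𝓡 (2 * n + 1)) T.reeb Y x = D Y x (T.reeb x) - D T.reeb x (Y x) := by
  have := D.torsion_apply (T.smoothAt_reeb x).diffAt hY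
  rw [h.reeb_torsion] at this
  exact (sub_eq_zero.1 this.symm).symm

/-- This is `d(dλ)(R, Y, Z) = 0`: with `[R, Y] = ∇_R Y - ∇_Y R` the `∇_R` terms cancel, as `dλ` is
parallel on `ξ`. It says that `J∇R` is `g`-symmetric on `ξ`. -/
theorem dlam_cov_reeb {x : M} {v w : Tan n x} (hv : T.lam x v = 0) (hw : T.lam x w = 0) :
    T.dlam x (D T.reeb x v) w = T.dlam x (D T.reeb x w) v := by
  obtain ⟨Y, hY, lY, rfl⟩ := T.exists_xi_extend hv
  obtain ⟨Z, hZ, lZ, rfl⟩ := T.exists_xi_extend hw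
  have := T.cyclic_dlam (T.smoothAt_reeb x) hY hZ
  have e : dfn n (fun _ : M ↦ (0 : ℝ)) x = 0 := dfn_const _ _
  rw [h.hermitian.dlam_parallel hY.diffAt hZ.diffAt lY lZ, h.bracket_reeb hY.diffAt,
    mlieBracket_swap (V := Z), Pi.neg_apply, h.bracket_reeb hZ.diffAt] at this
  simp only [dlam_reeb_left, dlam_reeb_right, map_sub, sub_apply, map_neg, neg_apply, e,
    zero_apply] at this
  have s := T.dlam_swap x (Y x) (D Z x (T.reeb x))
  linarith

theorem cyclic_torsion {x : M} {u v w : Tan n x} (hu : T.lam x u = 0) (hv : T.lam x v = 0)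
    (hw : T.lam x w = 0) : T.dlam x (D.torsion x u v) w
    + T.dlam x (D.torsion x v w) u + T.dlam x (D.torsion x w u) v = 0 := by
  obtain ⟨X, hX, lX, rfl⟩ := T.exists_xi_extend hu
  obtain ⟨Y, hY, lY, rfl⟩ := T.exists_xi_extend hv
  obtain ⟨Z, hZ, lZ, rfl⟩ := T.exists_xi_extend hw
  rw [D.torsion_apply hX.diffAt hY.diffAt, D.torsion_apply hY.diffAt hZ.diffAt,
    D.torsion_apply hZ.diffAt hX.diffAt]
  have := T.cyclic_dlam hX hY hZ
  rw [h.hermitian.dlam_parallel hY.diffAt hZ.diffAt lY lZ,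
    h.hermitian.dlam_parallel hZ.diffAt hX.diffAt lZ lX,
    h.hermitian.dlam_parallel hX.diffAt hY.diffAt lX lY] at this
  simp only [map_sub, sub_apply]
  rw [T.dlam_swap x (Y x) (D Z x (X x)), T.dlam_swap x (Z x) (D X x (Y x)),
    T.dlam_swap x (X x) (D Y x (Z x))] at this
  linarith

/-- If `∇R` anticommutes with `J`, then it is symmetric on `ξ`. -/
theorem cov_reeb_symm {x : M} (hA : ∀ v, T.lam x v = 0 →
    D T.reeb x (T.J x v) + T.J x (D T.reeb x v) = 0) {v w : Tan n x}
    (hv : T.lam x v = 0) (hw : T.lam x w = 0) :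
    T.g x (D T.reeb x v) w = T.g x (D T.reeb x w) v := by
  -- Symmetry of `J∇R` at `Jv`, together with anticommutation, becomes symmetry of `∇R`.
  have := h.dlam_cov_reeb (T.lam_J x v) hw
  rw [eq_neg_of_add_eq_zero_left (hA v hv), ← g_J_left_eq_dlam, ← g_J_left_eq_dlam, map_neg, J_J,
    neg_neg, T.g_proj_left_of_lam _ hw, g_J_J, T.g_proj_left_of_lam _ hv] at this
  exact this

/-- The `(2,0)` part of the torsion vanishes together with its `(1,1)` part. -/
theorem proj_torsion_J {x : M} (hT : ∀ v, T.lam x v = 0 →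
      T.proj x (D.torsion x (T.J x v) v) = 0) {u v : Tan n x}
    (hu : T.lam x u = 0) (hv : T.lam x v = 0) :
    T.proj x (D.torsion x (T.J x u) v) = -T.J x (D.torsion x u v) := by
  have key : ∀ {a b : Tan n x} (w : Tan n x), T.lam x a = 0 → T.lam x b = 0 →
      T.dlam x (D.torsion x (T.J x a) b) w = T.dlam x (D.torsion x a (T.J x b)) w := by
    intro a b w ha hb
    rw [← dlam_proj_left, proj_torsion_J_left hT ha hb, dlam_proj_left]
  have ju := T.lam_J x u
  have jv := T.lam_J x v
  have e : ∀ w, T.lam x w = 0 → T.dlam x (D.torsion x (T.J x u) v) w =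
      T.dlam x (D.torsion x u v) (T.J x w) := by
    intro w hw
    have jw := T.lam_J x w
    have e₁ := h.cyclic_torsion ju hv hw
    have e₂ := h.cyclic_torsion hu jv hw
    have e₃ := h.cyclic_torsion hu hv jw
    have e₄ := h.cyclic_torsion ju jv jw
    have k₁ := key w hu hv
    have k₂ := key u hv hw
    have k₃ := key v hw hu
    have k₄ := key (T.J x w) hu jv
    have k₅ := key (T.J x u) hv jw
    have k₆ := key (T.J x v) hw ju
    simp only [J_J, T.proj_of_lam_eq_zero hu, T.proj_of_lam_eq_zero hv, T.proj_of_lam_eq_zero hw,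
      map_neg, neg_apply] at k₄ k₅ k₆
    -- After substituting the `k`'s, `e₁ + e₂ - e₃ + e₄` leaves twice the difference of the two
    -- sides. This is the real form of the cyclic identity on two vectors of type `(1,0)` and one of
    -- type `(0,1)`.
    linarith
  refine T.eq_of_forall_g_xi (T.lam_proj x _) (by rw [map_neg, lam_J, neg_zero]) fun w hw ↦ ?_
  have e₁ := e _ (T.lam_J x w)
  rw [J_J, T.proj_of_lam_eq_zero hw, map_neg] at e₁
  rw [T.g_proj_left_of_lam _ hw, g_neg_left, g_J_left_eq_dlam, ← e₁, g_apply, hw, mul_zero,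
    add_zero]

end IsAdapted

theorem difference_apply' {Y : Π x : M, Tan n x} {x : M} (hY : DiffAt Y x) (v : Tan n x) :
    D.difference D' x (Y x) v = D Y x v - D' Y x v := by
  have : D.difference D' x (Y x) = D Y x - D' Y x :=
    IsCovariantDerivativeOn.difference_apply D.isCovariantDerivativeOnUniv
      D'.isCovariantDerivativeOnUniv (Set.mem_univ x) hY
  rw [this]
  rfl

theorem difference_reeb {x : M} (v : Tan n x) :
    D.difference D' x (T.reeb x) v = D T.reeb x v - D' T.reeb x v :=
  difference_apply' (T.smoothAt_reeb x).diffAt v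

omit [IsManifold (𝓡 (2 * n + 1)) ∞ M] in
theorem eq_zero_of_eq_neg {x : M} {v : Tan n x} (h : v = -v) : v = 0 := by
  have e : (2 : ℝ) • v = 0 := by
    rw [two_smul]
    exact add_eq_zero_iff_eq_neg.2 h
  simpa using e

/-! ### Uniqueness: the difference tensor vanishes. -/

namespace IsContactTriadConnection

variable {c : ℝ} (h : T.IsContactTriadConnection c D) (h' : T.IsContactTriadConnection c D')
include h h'

theorem difference_reeb_direction {x : M} (w : Tan n x) :
    D.difference D' x w (T.reeb x) = D.difference D' x (T.reeb x) w := by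
  obtain ⟨Y, hY, rfl⟩ := exists_smoothAt_extend w
  rw [difference_reeb, difference_apply' hY.diffAt]
  have e := h.isAdapted.bracket_reeb hY.diffAt
  rw [h'.isAdapted.bracket_reeb hY.diffAt] at e
  rw [sub_eq_sub_iff_sub_eq_sub]
  exact e.symm

theorem difference_skew {x : M} (v w z : Tan n x) :
    T.g x (D.difference D' x w v) z + T.g x w (D.difference D' x z v) = 0 := by
  obtain ⟨Y, hY, rfl⟩ := exists_smoothAt_extend w
  obtain ⟨Z, hZ, rfl⟩ := exists_smoothAt_extend z
  have e := h.riemannian Y Z x v hY.diffAt hZ.diffAt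
  rw [h'.riemannian Y Z x v hY.diffAt hZ.diffAt] at e
  rw [difference_apply' hY.diffAt, difference_apply' hZ.diffAt, g_sub_left, map_sub]
  linarith

theorem difference_J {x : M} {w : Tan n x} (hw : T.lam x w = 0) (v : Tan n x) :
    T.proj x (D.difference D' x (T.J x w) v) = T.J x (D.difference D' x w v) := by
  obtain ⟨Y, hY, lY, rfl⟩ := T.exists_xi_extend hw
  have e := (h.hermitian Y Y x v lY lY hY.diffAt hY.diffAt).2
  have e' := (h'.hermitian Y Y x v lY lY hY.diffAt hY.diffAt).2
  rw [difference_apply' hY.diffAt, difference_apply' (Y := fun y ↦ T.J y (Y y))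
    (T.diffAt_J hY.diffAt), proj_sub, e, e', map_sub, J_proj, J_proj]

/-- As an endomorphism of `ξ`, the difference of the two `∇R` anticommutes with `J`, the constants
`c` cancelling. By the Reeb torsion condition it is also the difference tensor in direction `R`,
which commutes with `J`. -/
theorem difference_reeb_eq_zero {x : M} (v : Tan n x) : D.difference D' x (T.reeb x) v = 0 := by
  have l : ∀ v, T.lam x (D.difference D' x (T.reeb x) v) = 0 := fun v ↦ by
    rw [difference_reeb, map_sub, h.riemannian.lam_cov_reeb, h'.riemannian.lam_cov_reeb,
      sub_zero]
  have key : ∀ v, T.lam x v = 0 → D.difference D' x (T.reeb x) v = 0 := by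
    intro v hv
    have e₁ := h.difference_J h' hv (T.reeb x)
    rw [h.difference_reeb_direction h', h.difference_reeb_direction h',
      T.proj_of_lam_eq_zero (l _)] at e₁
    have e₂ : D.difference D' x (T.reeb x) (T.J x v) =
        -T.J x (D.difference D' x (T.reeb x) v) := by
      have a := h.cauchyRiemann x v hv
      have a' := h'.cauchyRiemann x v hv
      rw [difference_reeb, difference_reeb, map_sub]
      linear_combination (norm := module) a - a'
    have e₃ : T.J x (D.difference D' x (T.reeb x) v) = 0 := eq_zero_of_eq_neg (e₁.symm.trans e₂)
    have e₄ := congrArg (T.J x) e₃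
    rwa [J_J, map_zero, neg_eq_zero, T.proj_of_lam_eq_zero (l v)] at e₄
  rw [← T.proj_add_reeb x v, map_add, map_smul, key _ (T.lam_proj x v), difference_reeb,
    h.reeb_reeb, h'.reeb_reeb, sub_zero, smul_zero, add_zero]

theorem lam_difference {x : M} (v w : Tan n x) : T.lam x (D.difference D' x w v) = 0 := by
  have := h.difference_skew h' v w (T.reeb x)
  rwa [h.difference_reeb_eq_zero h', map_zero, add_zero, g_reeb_right] at this

theorem difference_torsion {x : M} {v w : Tan n x} (hv : T.lam x v = 0) (hw : T.lam x w = 0) :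
    D.difference D' x w (T.J x v) - D.difference D' x (T.J x v) w =
      D.difference D' x (T.J x w) v - D.difference D' x v (T.J x w) := by
  have key : ∀ a b : Tan n x, D.difference D' x b a - D.difference D' x a b =
      T.proj x (D.torsion x a b) - T.proj x (D'.torsion x a b) := by
    intro a b
    rw [← T.proj_of_lam_eq_zero (h.lam_difference h' a b),
      ← T.proj_of_lam_eq_zero (h.lam_difference h' b a), ← proj_sub, ← proj_sub]
    congr 1
    obtain ⟨X, hX, rfl⟩ := exists_smoothAt_extend a
    obtain ⟨Y, hY, rfl⟩ := exists_smoothAt_extend b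
    rw [difference_apply' hX.diffAt, difference_apply' hY.diffAt,
      D.torsion_apply hX.diffAt hY.diffAt, D'.torsion_apply hX.diffAt hY.diffAt]
    abel
  rw [key, key, proj_torsion_J_left (h.torsion_xi x) hv hw,
    proj_torsion_J_left (h'.torsion_xi x) hv hw]

theorem difference_eq_zero_of_lam {x : M} {v w : Tan n x} (hv : T.lam x v = 0)
    (hw : T.lam x w = 0) : D.difference D' x w v = 0 := by
  set S : Tan n x →L[ℝ] Tan n x →L[ℝ] Tan n x := D.difference D' x with hS
  have lS : ∀ a b, T.lam x (S b a) = 0 := h.lam_difference h'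
  have SJ : ∀ a {b}, T.lam x b = 0 → S (T.J x b) a = T.J x (S b a) := fun a b hb ↦ by
    rw [← h.difference_J h' hb, T.proj_of_lam_eq_zero (lS _ _)]
  have JJ : ∀ a b, T.J x (T.J x (S b a)) = -S b a := fun a b ↦ by
    rw [J_J, T.proj_of_lam_eq_zero (lS _ _)]
  have Jv : ∀ {a}, T.lam x a = 0 → T.J x (T.J x a) = -a := fun ha ↦ T.J_sq x _ ha
  have N_anti : ∀ {a b}, T.lam x a = 0 → T.lam x b = 0 →
      S b (T.J x a) - T.J x (S b a) = -(S a (T.J x b) - T.J x (S a b)) := by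
    intro a b ha hb
    have := h.difference_torsion h' ha hb
    rw [← hS, SJ _ ha, SJ _ hb] at this
    linear_combination (norm := module) this
  -- `N(a, b) = S_{Ja} b - J S_a b` is antilinear in `a`, linear in `b` and, by `N_anti`,
  -- antisymmetric; such a map is zero.
  have N_zero : ∀ {a b}, T.lam x a = 0 → T.lam x b = 0 → S b (T.J x a) = T.J x (S b a) := by
    intro a b ha hb
    have e₁ := N_anti (T.lam_J x a) hb
    have e₂ := congrArg (T.J x) (N_anti ha hb)
    rw [Jv ha, SJ _ ha, SJ _ ha, JJ] at e₁
    simp only [map_neg, map_sub, JJ] at e₁ e₂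
    have e₃ : T.J x (S b (T.J x a)) = -S b a :=
      eq_neg_of_add_eq_zero_left (eq_zero_of_eq_neg (by
        linear_combination (norm := module) e₂ - e₁))
    have e₄ := congrArg (T.J x) e₃
    rw [JJ, map_neg] at e₄
    exact neg_injective e₄
  -- `J S_v` is skew because it is `S_{Jv}`, and symmetric because `J` and `S_v` are commuting skew
  -- maps.
  have e : ∀ z, T.lam x z = 0 → T.g x (T.J x (S w v)) z = 0 := by
    intro z hz
    have s₁ := h.difference_skew h' (T.J x v) w z
    have s₂ := h.difference_skew h' v w (T.J x z)
    rw [← hS, N_zero hv hw, N_zero hv hz] at s₁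
    rw [← hS, SJ _ hz] at s₂
    rw [T.g_J_left] at s₁ ⊢
    linarith
  have e' : T.J x (S w v) = 0 := T.eq_of_forall_g_xi (T.lam_J x _) (map_zero _) fun z hz ↦ by
    rw [e z hz, map_zero, LinearMap.zero_apply]
  rw [← neg_eq_zero, ← JJ, e', map_zero]

/-- Uniqueness of `c`-contact triad connections. -/
theorem agrees : D.Agrees D' := by
  intro X x hX
  ext1 v
  rw [← sub_eq_zero, ← difference_apply' hX]
  have e : D.difference D' x (T.proj x (X x)) (T.proj x v) = 0 :=
    h.difference_eq_zero_of_lam h' (T.lam_proj x v) (T.lam_proj x _)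
  rw [← T.proj_add_reeb x v, ← T.proj_add_reeb x (X x)]
  simp only [map_add, map_smul, add_apply, smul_apply, e, h.difference_reeb_direction h',
    h.difference_reeb_eq_zero h', smul_zero, add_zero]

end IsContactTriadConnection

end ContactTriad

/-! ### Complexification and types. -/

section Complexification

variable {V : Type*} [AddCommGroup V] [Module ℝ V] {W : Type*} [AddCommGroup W] [Module ℂ W]

theorem complexification_ext {f g : ℂ ⊗[ℝ] V →ₗ[ℂ] W}
    (h : ∀ v, f ((1 : ℂ) ⊗ₜ[ℝ] v) = g ((1 : ℂ) ⊗ₜ[ℝ] v)) : f = g := by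
  ext v
  exact h v

theorem complexification_ext₂ {f g : ℂ ⊗[ℝ] V →ₗ[ℂ] ℂ ⊗[ℝ] V →ₗ[ℂ] W}
    (h : ∀ v w, f ((1 : ℂ) ⊗ₜ[ℝ] v) ((1 : ℂ) ⊗ₜ[ℝ] w) = g ((1 : ℂ) ⊗ₜ[ℝ] v) ((1 : ℂ) ⊗ₜ[ℝ] w)) :
    f = g :=
  complexification_ext fun v ↦ complexification_ext fun w ↦ h v w

theorem extC_one_tmul (a : V →ₗ[ℝ] ℝ) (v : V) : extC a ((1 : ℂ) ⊗ₜ[ℝ] v) = (a v : ℂ) := by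
  simp [extC]

theorem baseChange_one_tmul (L : V →ₗ[ℝ] V) (v : V) :
    L.baseChange ℂ ((1 : ℂ) ⊗ₜ[ℝ] v) = (1 : ℂ) ⊗ₜ[ℝ] L v := by simp

theorem one_tmul_smul (c : ℝ) (v : V) :
    (1 : ℂ) ⊗ₜ[ℝ] (c • v) = (c : ℂ) • (1 : ℂ) ⊗ₜ[ℝ] v := by
  rw [← TensorProduct.smul_tmul, TensorProduct.smul_tmul']
  congr 1

/-- The wedge product of two one-forms as a bilinear map. -/
def wedgeHom {V : Type*} [AddCommGroup V] [Module ℂ V] (a b : V →ₗ[ℂ] ℂ) : V →ₗ[ℂ] V →ₗ[ℂ] ℂ :=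
  LinearMap.mk₂ ℂ (wedge a b)
    (by intros; simp only [wedge, map_add]; ring)
    (by intros; simp only [wedge, map_smul, smul_eq_mul]; ring)
    (by intros; simp only [wedge, map_add]; ring)
    (by intros; simp only [wedge, map_smul, smul_eq_mul]; ring)

theorem wedgeHom_apply {V : Type*} [AddCommGroup V] [Module ℂ V] (a b : V →ₗ[ℂ] ℂ) (Z W : V) :
    wedgeHom a b Z W = wedge a b Z W := rfl

end Complexification

namespace ContactTriad

variable {n : ℕ} {M : Type*} [TopologicalSpace M] [ChartedSpace (ModelE n) M]
  [IsManifold (𝓡 (2 * n + 1)) ∞ M] (T : ContactTriad n M) {D : AffineConnection n M}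

theorem JC_one_tmul (x : M) (v : Tan n x) :
    T.JC x ((1 : ℂ) ⊗ₜ[ℝ] v) = (1 : ℂ) ⊗ₜ[ℝ] T.J x v :=
  baseChange_one_tmul _ v

theorem lamC_one_tmul (x : M) (v : Tan n x) : T.lamC x ((1 : ℂ) ⊗ₜ[ℝ] v) = (T.lam x v : ℂ) :=
  extC_one_tmul _ v

theorem dlamC_one_tmul (x : M) (v w : Tan n x) :
    T.dlamC x ((1 : ℂ) ⊗ₜ[ℝ] v) ((1 : ℂ) ⊗ₜ[ℝ] w) = (T.dlam x v w : ℂ) := by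
  simp [dlamC]

theorem _root_.AffineConnection.covC_one_tmul (D : AffineConnection n M) (X : Π x : M, Tan n x)
    (x : M) (v : Tan n x) : D.covC X x ((1 : ℂ) ⊗ₜ[ℝ] v) = (1 : ℂ) ⊗ₜ[ℝ] D X x v :=
  baseChange_one_tmul _ v

theorem _root_.AffineConnection.torsionC_one_tmul (D : AffineConnection n M) (x : M)
    (v w : Tan n x) : D.torsionC x ((1 : ℂ) ⊗ₜ[ℝ] v) ((1 : ℂ) ⊗ₜ[ℝ] w) =
      (1 : ℂ) ⊗ₜ[ℝ] D.torsion x v w := by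
  simp [AffineConnection.torsionC]

theorem xi10_mem {x : M} {v : Tan n x} (hv : T.lam x v = 0) :
    (1 : ℂ) ⊗ₜ[ℝ] v - Complex.I • (1 : ℂ) ⊗ₜ[ℝ] T.J x v ∈ T.xi10 x := by
  change T.JC x _ = _
  rw [map_sub, map_smul, JC_one_tmul, JC_one_tmul, T.J_sq x v hv, TensorProduct.tmul_neg, smul_sub,
    smul_smul, Complex.I_mul_I]
  module

theorem xi01_mem {x : M} {v : Tan n x} (hv : T.lam x v = 0) :
    (1 : ℂ) ⊗ₜ[ℝ] v + Complex.I • (1 : ℂ) ⊗ₜ[ℝ] T.J x v ∈ T.xi01 x := by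
  change T.JC x _ = _
  rw [map_add, map_smul, JC_one_tmul, JC_one_tmul, T.J_sq x v hv, TensorProduct.tmul_neg, smul_add,
    smul_smul, Complex.I_mul_I]
  module

/-- On the eigenspace, `J - √-1 J²` is multiplication by `2√-1`, so `Z` is a combination of the
vectors `v - √-1 Jv` with `v` in the image of `J`, hence in `ξ`. -/
theorem eq_zero_of_mem_xi10 {W : Type*} [AddCommGroup W] [Module ℂ W] {x : M}
    {f : TanC n x →ₗ[ℂ] W} (h : ∀ v, T.lam x v = 0 →
      f ((1 : ℂ) ⊗ₜ[ℝ] v - Complex.I • (1 : ℂ) ⊗ₜ[ℝ] T.J x v) = 0) {Z : TanC n x}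
    (hZ : Z ∈ T.xi10 x) : f Z = 0 := by
  have hZ' : T.JC x Z = Complex.I • Z := hZ
  have e : f ∘ₗ (T.JC x - Complex.I • T.JC x ∘ₗ T.JC x) = 0 := complexification_ext fun v ↦ by
    simpa [JC_one_tmul] using h _ (T.lam_J x v)
  have e' := LinearMap.congr_fun e Z
  simp only [LinearMap.comp_apply, LinearMap.sub_apply, LinearMap.smul_apply, hZ', map_smul,
    LinearMap.zero_apply, smul_smul, Complex.I_mul_I] at e'
  have e₂ : Complex.I • Z - (Complex.I * -1) • Z = (2 * Complex.I) • Z := by module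
  rw [e₂, map_smul] at e'
  exact (smul_eq_zero.1 e').resolve_left (by simp)

theorem eq_zero_of_mem_xi01 {W : Type*} [AddCommGroup W] [Module ℂ W] {x : M}
    {f : TanC n x →ₗ[ℂ] W} (h : ∀ v, T.lam x v = 0 →
      f ((1 : ℂ) ⊗ₜ[ℝ] v + Complex.I • (1 : ℂ) ⊗ₜ[ℝ] T.J x v) = 0) {Z : TanC n x}
    (hZ : Z ∈ T.xi01 x) : f Z = 0 := by
  have hZ' : T.JC x Z = (-Complex.I) • Z := by rw [neg_smul]; exact hZ
  have e : f ∘ₗ (T.JC x + Complex.I • T.JC x ∘ₗ T.JC x) = 0 := complexification_ext fun v ↦ by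
    simpa [JC_one_tmul] using h _ (T.lam_J x v)
  have e' := LinearMap.congr_fun e Z
  simp only [LinearMap.comp_apply, LinearMap.add_apply, LinearMap.smul_apply, hZ', map_smul,
    LinearMap.zero_apply, smul_smul] at e'
  rw [← add_smul, map_smul] at e'
  refine (smul_eq_zero.1 e').resolve_left ?_
  simp [← two_mul]

theorem vanishes11_iff {x : M} (b : TanC n x →ₗ[ℂ] TanC n x →ₗ[ℂ] ℂ) :
    T.Vanishes11 x (fun Z W ↦ b Z W) ↔ ∀ v w, T.lam x v = 0 → T.lam x w = 0 →
      b ((1 : ℂ) ⊗ₜ[ℝ] v - Complex.I • (1 : ℂ) ⊗ₜ[ℝ] T.J x v)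
        ((1 : ℂ) ⊗ₜ[ℝ] w + Complex.I • (1 : ℂ) ⊗ₜ[ℝ] T.J x w) = 0 := by
  refine ⟨fun h v w hv hw ↦ h _ (T.xi10_mem hv) _ (T.xi01_mem hw), fun h Z hZ W hW ↦ ?_⟩
  refine T.eq_zero_of_mem_xi01 (f := b Z) (fun w hw ↦ ?_) hW
  exact T.eq_zero_of_mem_xi10 (f := b.flip _) (fun v hv ↦ h v w hv hw) hZ

theorem vanishes20_of_real {x : M} (b : TanC n x →ₗ[ℂ] TanC n x →ₗ[ℂ] ℂ)
    (h : ∀ v w, T.lam x v = 0 → T.lam x w = 0 →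
      b ((1 : ℂ) ⊗ₜ[ℝ] v - Complex.I • (1 : ℂ) ⊗ₜ[ℝ] T.J x v)
        ((1 : ℂ) ⊗ₜ[ℝ] w - Complex.I • (1 : ℂ) ⊗ₜ[ℝ] T.J x w) = 0) :
    T.Vanishes20 x (fun Z W ↦ b Z W) := by
  intro Z hZ W hW
  refine T.eq_zero_of_mem_xi10 (f := b Z) (fun w hw ↦ ?_) hW
  exact T.eq_zero_of_mem_xi10 (f := b.flip _) (fun v hv ↦ h v w hv hw) hZ

/-! ### The torsion conditions in a frame, in real terms. -/

namespace Frame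

variable {T} (B : T.Frame)

theorem theta_one_tmul (k : Fin n) (x : M) (v : Tan n x) : B.theta k x ((1 : ℂ) ⊗ₜ[ℝ] v) =
    (1 / (Real.sqrt 2 : ℂ)) * (T.g x (B.E k x) v + Complex.I * T.g x (B.F k x) v) := by
  simp only [theta, LinearMap.smul_apply, LinearMap.add_apply, smul_eq_mul, extC_one_tmul]

theorem thetaBar_one_tmul (k : Fin n) (x : M) (v : Tan n x) :
    B.thetaBar k x ((1 : ℂ) ⊗ₜ[ℝ] v) =
      (1 / (Real.sqrt 2 : ℂ)) * (T.g x (B.E k x) v - Complex.I * T.g x (B.F k x) v) := by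
  simp only [thetaBar, LinearMap.smul_apply, LinearMap.sub_apply, smul_eq_mul, extC_one_tmul]

theorem theta_J (k : Fin n) {x : M} (hx : x ∈ B.U) (v : Tan n x) :
    B.theta k x ((1 : ℂ) ⊗ₜ[ℝ] T.J x v) = Complex.I * B.theta k x ((1 : ℂ) ⊗ₜ[ℝ] v) := by
  rw [theta_one_tmul, theta_one_tmul, ← neg_eq_iff_eq_neg.2 (T.g_J_left x (B.E k x) v),
    ← neg_eq_iff_eq_neg.2 (T.g_J_left x (B.F k x) v), J_E, B.J_F k hx, g_neg_left]
  push_cast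
  linear_combination (1 / (Real.sqrt 2 : ℂ)) * -(T.g x (B.F k x) v : ℂ) * Complex.I_sq

theorem theta_proj (k : Fin n) {x : M} (hx : x ∈ B.U) (v : Tan n x) :
    B.theta k x ((1 : ℂ) ⊗ₜ[ℝ] T.proj x v) = B.theta k x ((1 : ℂ) ⊗ₜ[ℝ] v) := by
  rw [theta_one_tmul, theta_one_tmul, ← g_proj_left, ← g_proj_left,
    T.proj_of_lam_eq_zero (B.lam_E k hx), T.proj_of_lam_eq_zero (B.lam_F k x)]

theorem proj_eq_zero_of_theta {x : M} (hx : x ∈ B.U) {v : Tan n x}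
    (h : ∀ k, B.theta k x ((1 : ℂ) ⊗ₜ[ℝ] v) = 0) : T.proj x v = 0 := by
  have hk : ∀ k, T.g x (B.E k x) v = 0 ∧ T.g x (B.F k x) v = 0 := by
    intro k
    have := h k
    rw [theta_one_tmul, mul_eq_zero_iff_left (by simp)] at this
    have re := congrArg Complex.re this
    have im := congrArg Complex.im this
    simp at re im
    exact ⟨re, im⟩
  have := B.expand hx v
  simp only [(hk _).1, (hk _).2, zero_smul, add_zero, Finset.sum_const_zero, zero_add] at this
  rw [proj, sub_eq_zero]
  exact this

theorem theta_eq_zero_iff {x : M} (hx : x ∈ B.U) {v : Tan n x} :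
    (∀ k, B.theta k x ((1 : ℂ) ⊗ₜ[ℝ] v) = 0) ↔ T.proj x v = 0 := by
  refine ⟨B.proj_eq_zero_of_theta hx, fun h k ↦ ?_⟩
  rw [← B.theta_proj k hx, h, TensorProduct.tmul_zero, map_zero]

theorem Theta_10_01 (D : AffineConnection n M) (k : Fin n) {x : M} (hx : x ∈ B.U) (v w : Tan n x) :
    B.Theta D k x ((1 : ℂ) ⊗ₜ[ℝ] v - Complex.I • (1 : ℂ) ⊗ₜ[ℝ] T.J x v)
        ((1 : ℂ) ⊗ₜ[ℝ] w + Complex.I • (1 : ℂ) ⊗ₜ[ℝ] T.J x w) =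
      B.theta k x ((1 : ℂ) ⊗ₜ[ℝ] (D.torsion x v w + D.torsion x (T.J x v) (T.J x w)
        + T.J x (D.torsion x v (T.J x w) - D.torsion x (T.J x v) w))) := by
  simp only [Theta, map_add, map_sub, map_smul, LinearMap.sub_apply, LinearMap.smul_apply,
    AffineConnection.torsionC_one_tmul, TensorProduct.tmul_add, TensorProduct.tmul_sub,
    B.theta_J k hx, smul_eq_mul]
  linear_combination -(B.theta k x ((1 : ℂ) ⊗ₜ[ℝ] D.torsion x (T.J x v) (T.J x w))) *
    Complex.I_mul_I

theorem Theta_10_10 (D : AffineConnection n M) (k : Fin n) {x : M} (hx : x ∈ B.U) (v w : Tan n x) :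
    B.Theta D k x ((1 : ℂ) ⊗ₜ[ℝ] v - Complex.I • (1 : ℂ) ⊗ₜ[ℝ] T.J x v)
        ((1 : ℂ) ⊗ₜ[ℝ] w - Complex.I • (1 : ℂ) ⊗ₜ[ℝ] T.J x w) =
      B.theta k x ((1 : ℂ) ⊗ₜ[ℝ] (D.torsion x v w - D.torsion x (T.J x v) (T.J x w)
        - T.J x (D.torsion x v (T.J x w) + D.torsion x (T.J x v) w))) := by
  simp only [Theta, map_add, map_sub, map_smul, LinearMap.sub_apply, LinearMap.smul_apply,
    AffineConnection.torsionC_one_tmul, TensorProduct.tmul_add, TensorProduct.tmul_sub,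
    B.theta_J k hx, smul_eq_mul]
  linear_combination (B.theta k x ((1 : ℂ) ⊗ₜ[ℝ] D.torsion x (T.J x v) (T.J x w))) *
    Complex.I_mul_I

/-- The `(1,1)` part, evaluated on the vectors built from `v` and `w`, is `θ^k` of a real
expression; for `v = w` this expression is `-2J T(Jv, v)`. The converse uses the polarized identity
at `w` and at `Jw`. -/
theorem vanishes11_Theta_iff {x : M} (hx : x ∈ B.U) :
    (∀ k, T.Vanishes11 x (B.Theta D k x)) ↔
      ∀ v, T.lam x v = 0 → T.proj x (D.torsion x (T.J x v) v) = 0 := by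
  have e : (∀ k, T.Vanishes11 x (B.Theta D k x)) ↔ ∀ v w, T.lam x v = 0 → T.lam x w = 0 →
      T.proj x (D.torsion x v w + D.torsion x (T.J x v) (T.J x w)
        + T.J x (D.torsion x v (T.J x w) - D.torsion x (T.J x v) w)) = 0 := by
    have e₁ : ∀ k, T.Vanishes11 x (B.Theta D k x) ↔ _ := fun k ↦
      T.vanishes11_iff ((D.torsionC x).compr₂ (B.theta k x))
    simp only [e₁, ← B.theta_eq_zero_iff hx, ← B.Theta_10_01 D _ hx]
    exact ⟨fun h v w hv hw k ↦ h k v w hv hw, fun h k v w hv hw ↦ h v w hv hw k⟩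
  rw [e]
  constructor
  · intro h v hv
    have := h v v hv hv
    rw [D.torsion_self, D.torsion_self, D.torsion_antisymm v (T.J x v), add_zero, zero_add,
      proj_J] at this
    have e₂ := congrArg (T.J x) this
    rw [J_J, map_zero, neg_eq_zero, proj_sub, proj_neg] at e₂
    exact eq_zero_of_eq_neg (eq_neg_of_add_eq_zero_left (by
      linear_combination (norm := module) -e₂))
  · intro h v w hv hw
    have e₂ := proj_torsion_J_left h hv hw
    have e₃ := proj_torsion_J_left h hv (T.lam_J x w)
    rw [T.J_sq x w hw, map_neg, proj_neg] at e₃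
    rw [proj_add, proj_add, e₃, proj_J, ← J_proj, proj_sub, e₂, sub_self, map_zero]
    module

theorem vanishes20_Theta (h : T.IsAdapted D) {x : M} (hx : x ∈ B.U)
    (hT : ∀ v, T.lam x v = 0 → T.proj x (D.torsion x (T.J x v) v) = 0) (k : Fin n) :
    T.Vanishes20 x (B.Theta D k x) := by
  refine T.vanishes20_of_real ((D.torsionC x).compr₂ (B.theta k x)) fun v w hv hw ↦ ?_
  change B.Theta D k x _ _ = 0
  rw [B.Theta_10_10 D k hx]
  refine (B.theta_eq_zero_iff hx).2 ?_ k
  have e₁ := h.proj_torsion_J hT hv hw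
  have e₂ := proj_torsion_J_left hT hv hw
  have e₃ := h.proj_torsion_J hT hv (T.lam_J x w)
  rw [← T.J_proj x (D.torsion x v (T.J x w)), ← e₂, e₁, map_neg, J_J, neg_neg] at e₃
  rw [proj_sub, proj_sub, e₃, proj_J, ← J_proj, proj_add, ← e₂, e₁, map_add, map_neg, J_J]
  module

/-- Since `∇_R R = 0`, `α_k` is its own horizontal part, and since `θ^k ∘ J = √-1 θ^k`, the
condition is `θ^k` of the real equation. In direction `R` both sides vanish. -/
theorem alpha_iff (h : T.IsAdapted D) (c : ℝ) {x : M} (hx : x ∈ B.U) :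
    (∀ k, ∀ Z : TanC n x, B.alpha D k x (T.JC x Z) =
      -Complex.I * T.horizontal x (B.alpha D k x) Z + (c : ℂ) * B.theta k x Z) ↔
      ∀ v, T.lam x v = 0 → D T.reeb x (T.J x v) + T.J x (D T.reeb x v) = c • v := by
  have e : (∀ k, ∀ Z : TanC n x, B.alpha D k x (T.JC x Z) =
      -Complex.I * T.horizontal x (B.alpha D k x) Z + (c : ℂ) * B.theta k x Z) ↔
      ∀ v, T.proj x (D T.reeb x (T.J x v) + T.J x (D T.reeb x v) - c • v) = 0 := by
    have e₁ : ∀ k, (∀ Z : TanC n x, B.alpha D k x (T.JC x Z) =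
        -Complex.I * T.horizontal x (B.alpha D k x) Z + (c : ℂ) * B.theta k x Z) ↔
        ∀ v, B.theta k x ((1 : ℂ) ⊗ₜ[ℝ]
          (D T.reeb x (T.J x v) + T.J x (D T.reeb x v) - c • v)) = 0 := by
      intro k
      have e₂ : ∀ v, B.theta k x ((1 : ℂ) ⊗ₜ[ℝ]
          (D T.reeb x (T.J x v) + T.J x (D T.reeb x v) - c • v)) =
          B.alpha D k x (T.JC x ((1 : ℂ) ⊗ₜ[ℝ] v)) - (-Complex.I * T.horizontal x (B.alpha D k x)
            ((1 : ℂ) ⊗ₜ[ℝ] v) + (c : ℂ) * B.theta k x ((1 : ℂ) ⊗ₜ[ℝ] v)) := by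
        intro v
        simp only [ContactTriad.horizontal, alpha, JC_one_tmul, LinearMap.sub_apply, LinearMap.smul_apply,
          LinearMap.comp_apply, AffineConnection.covC_one_tmul, reebC, h.cov_reeb_reeb,
          TensorProduct.tmul_zero, map_zero, TensorProduct.tmul_add, TensorProduct.tmul_sub,
          map_add, map_sub, B.theta_J k hx, one_tmul_smul, map_smul, smul_eq_mul]
        ring
      simp only [e₂, sub_eq_zero]
      refine ⟨fun H v ↦ H _, fun H ↦ ?_⟩
      have := complexification_ext (f := (B.alpha D k x) ∘ₗ (T.JC x))
        (g := (-Complex.I) • T.horizontal x (B.alpha D k x) + (c : ℂ) • B.theta k x) H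
      exact fun Z ↦ LinearMap.congr_fun this Z
    simp only [e₁, ← B.theta_eq_zero_iff hx]
    exact forall_comm
  have lA : ∀ v, T.proj x (D T.reeb x v) = D T.reeb x v := fun v ↦
    T.proj_of_lam_eq_zero (h.riemannian.lam_cov_reeb x v)
  rw [e]
  simp only [proj_sub, proj_add, proj_J, proj_smul, lA, sub_eq_zero]
  refine ⟨fun H v hv ↦ by simpa only [T.proj_of_lam_eq_zero hv] using H v, fun H v ↦ ?_⟩
  have e₄ : D T.reeb x (T.proj x v) = D T.reeb x v := by
    rw [proj, map_sub, map_smul, h.cov_reeb_reeb, smul_zero, sub_zero]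
  rw [← H _ (T.lam_proj x v), J_proj, e₄]

theorem lam_cov_E (h : T.IsRiemannian D) (k : Fin n) {x : M} (hx : x ∈ B.U) (v : Tan n x) :
    T.lam x (D (B.E k) x v) = -T.g x (B.E k x) (D T.reeb x v) := by
  rw [h.lam_cov_of_lam_eq_zero (B.smoothAt_E k hx).diffAt, T.g_symm]
  filter_upwards [B.isOpen.mem_nhds hx] with y hy using B.lam_E k hy

theorem lam_cov_F (h : T.IsRiemannian D) (k : Fin n) {x : M} (hx : x ∈ B.U) (v : Tan n x) :
    T.lam x (D (B.F k) x v) = -T.g x (B.F k x) (D T.reeb x v) := by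
  rw [h.lam_cov_of_lam_eq_zero (B.smoothAt_F k hx).diffAt, T.g_symm]
  exact Filter.Eventually.of_forall fun y ↦ B.lam_F k y

theorem g_E_J (k : Fin n) (x : M) (v : Tan n x) :
    T.g x (B.E k x) (T.J x v) = -T.g x (B.F k x) v := by
  rw [← J_E, g_J_left, neg_neg]

theorem g_F_J (k : Fin n) {x : M} (hx : x ∈ B.U) (v : Tan n x) :
    T.g x (B.F k x) (T.J x v) = T.g x (B.E k x) v := by
  rw [← neg_eq_iff_eq_neg.2 (T.g_J_left x (B.F k x) v), B.J_F k hx, g_neg_left, neg_neg]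

theorem one_div_sqrt_two_sq : (1 / (Real.sqrt 2 : ℂ)) * (1 / (Real.sqrt 2 : ℂ)) = 1 / 2 := by
  rw [div_mul_div_comm, one_mul, ← Complex.ofReal_mul, Real.mul_self_sqrt zero_le_two,
    Complex.ofReal_ofNat]

theorem reebCoeff_one_tmul (h : T.IsRiemannian D) (k : Fin n) {x : M} (hx : x ∈ B.U)
    (v : Tan n x) : B.reebCoeff D k x ((1 : ℂ) ⊗ₜ[ℝ] v) = -(1 / (Real.sqrt 2 : ℂ)) *
      (T.g x (B.E k x) (D T.reeb x v) - Complex.I * T.g x (B.F k x) (D T.reeb x v)) := by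
  simp only [reebCoeff, covEta, LinearMap.comp_apply, LinearMap.smul_apply, LinearMap.sub_apply,
    AffineConnection.covC_one_tmul, map_smul, map_sub, lamC_one_tmul, smul_eq_mul,
    B.lam_cov_E h k hx, B.lam_cov_F h k hx]
  push_cast
  ring

theorem reebCoeffBar_one_tmul (h : T.IsRiemannian D) (k : Fin n) {x : M} (hx : x ∈ B.U)
    (v : Tan n x) : B.reebCoeffBar D k x ((1 : ℂ) ⊗ₜ[ℝ] v) = -(1 / (Real.sqrt 2 : ℂ)) *
      (T.g x (B.E k x) (D T.reeb x v) + Complex.I * T.g x (B.F k x) (D T.reeb x v)) := by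
  simp only [reebCoeffBar, covEtaBar, LinearMap.comp_apply, LinearMap.smul_apply,
    LinearMap.add_apply, AffineConnection.covC_one_tmul, map_smul, map_add, lamC_one_tmul,
    smul_eq_mul, B.lam_cov_E h k hx, B.lam_cov_F h k hx]
  push_cast
  ring

/-- The frame sum in invariant form. Its conjugate is `sum_reebCoeffBar_mul_thetaBar`, and the two
add up to `-g(∇_v R, w)`, the term that occurs in `lam_torsion`. -/
theorem sum_reebCoeff_mul_theta (h : T.IsRiemannian D) {x : M} (hx : x ∈ B.U) (v w : Tan n x) :
    ∑ k, B.reebCoeff D k x ((1 : ℂ) ⊗ₜ[ℝ] v) * B.theta k x ((1 : ℂ) ⊗ₜ[ℝ] w) =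
      -(1 / 2) * (T.g x (D T.reeb x v) w + Complex.I * T.g x (T.J x (D T.reeb x v)) w) := by
  rw [B.g_eq_sum hx (D T.reeb x v), B.g_eq_sum hx (T.J x (D T.reeb x v)),
    h.lam_cov_reeb, lam_J, zero_mul, add_zero, add_zero]
  push_cast
  rw [Finset.mul_sum, ← Finset.sum_add_distrib, Finset.mul_sum]
  refine Finset.sum_congr rfl fun k _ ↦ ?_
  rw [B.reebCoeff_one_tmul h k hx, theta_one_tmul, B.g_E_J, B.g_F_J k hx]
  push_cast
  generalize T.g x (B.E k x) (D T.reeb x v) = a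
  generalize T.g x (B.F k x) (D T.reeb x v) = b
  generalize T.g x (B.E k x) w = p
  generalize T.g x (B.F k x) w = q
  linear_combination (-(a - Complex.I * b) * (p + Complex.I * q) : ℂ) * one_div_sqrt_two_sq
    + (1 / 2 * b * q : ℂ) * Complex.I_mul_I

theorem sum_reebCoeffBar_mul_thetaBar (h : T.IsRiemannian D) {x : M} (hx : x ∈ B.U)
    (v w : Tan n x) :
    ∑ k, B.reebCoeffBar D k x ((1 : ℂ) ⊗ₜ[ℝ] v) * B.thetaBar k x ((1 : ℂ) ⊗ₜ[ℝ] w) =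
      -(1 / 2) * (T.g x (D T.reeb x v) w - Complex.I * T.g x (T.J x (D T.reeb x v)) w) := by
  rw [B.g_eq_sum hx (D T.reeb x v), B.g_eq_sum hx (T.J x (D T.reeb x v)),
    h.lam_cov_reeb, lam_J, zero_mul, add_zero, add_zero]
  push_cast
  rw [Finset.mul_sum, ← Finset.sum_sub_distrib, Finset.mul_sum]
  refine Finset.sum_congr rfl fun k _ ↦ ?_
  rw [B.reebCoeffBar_one_tmul h k hx, thetaBar_one_tmul, B.g_E_J, B.g_F_J k hx]
  push_cast
  generalize T.g x (B.E k x) (D T.reeb x v) = a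
  generalize T.g x (B.F k x) (D T.reeb x v) = b
  generalize T.g x (B.E k x) w = p
  generalize T.g x (B.F k x) w = q
  linear_combination (-(a + Complex.I * b) * (p - Complex.I * q) : ℂ) * one_div_sqrt_two_sq
    + (1 / 2 * b * q : ℂ) * Complex.I_mul_I

theorem Theta0_eq (h : T.IsRiemannian D) {x : M} (hx : x ∈ B.U) (Z W : TanC n x) :
    T.Theta0 D x Z W = T.dlamC x Z W
      + ∑ k, (wedge (B.reebCoeff D k x) (B.theta k x) Z W
        + wedge (B.reebCoeffBar D k x) (B.thetaBar k x) Z W) := by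
  have e : (D.torsionC x).compr₂ (T.lamC x) = T.dlamC x
      + ∑ k, (wedgeHom (B.reebCoeff D k x) (B.theta k x)
        + wedgeHom (B.reebCoeffBar D k x) (B.thetaBar k x)) := by
    refine complexification_ext₂ fun v w ↦ ?_
    simp only [LinearMap.compr₂_apply, LinearMap.add_apply, LinearMap.sum_apply, wedgeHom_apply,
      wedge, AffineConnection.torsionC_one_tmul, lamC_one_tmul, dlamC_one_tmul, h.lam_torsion,
      Finset.sum_add_distrib, Finset.sum_sub_distrib, B.sum_reebCoeff_mul_theta h hx,
      B.sum_reebCoeffBar_mul_thetaBar h hx]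
    push_cast
    ring
  have := LinearMap.congr_fun₂ e Z W
  simp only [LinearMap.compr₂_apply, LinearMap.add_apply, LinearMap.sum_apply, wedgeHom_apply]
    at this
  exact this

/-- The sum antisymmetrizes `g(Av, w) - √-1 g(JAv, w)` up to a factor. The second term is symmetric
for every adapted connection, the first because `A` anticommutes with `J`. -/
theorem sum_wedge_bar_eq_zero (h : T.IsAdapted D) {x : M} (hx : x ∈ B.U)
    (hA : ∀ v, T.lam x v = 0 → D T.reeb x (T.J x v) + T.J x (D T.reeb x v) = 0) (Z W : TanC n x) :
    ∑ k, wedge (B.reebCoeffBar D k x) (B.thetaBar k x) Z W = 0 := by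
  have lA := h.riemannian.lam_cov_reeb x
  have hπ : ∀ v, D T.reeb x (T.proj x v) = D T.reeb x v := fun v ↦ by
    rw [proj, map_sub, map_smul, h.cov_reeb_reeb, smul_zero, sub_zero]
  have s₁ : ∀ v w, T.g x (D T.reeb x v) w = T.g x (D T.reeb x w) v := by
    intro v w
    have := h.cov_reeb_symm hA (T.lam_proj x v) (T.lam_proj x w)
    rwa [hπ, hπ, ← g_proj_left, ← g_proj_left, T.proj_of_lam_eq_zero (lA _),
      T.proj_of_lam_eq_zero (lA _)] at this
  have s₂ : ∀ v w, T.g x (T.J x (D T.reeb x v)) w = T.g x (T.J x (D T.reeb x w)) v := by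
    intro v w
    have := h.dlam_cov_reeb (T.lam_proj x v) (T.lam_proj x w)
    rwa [hπ, hπ, dlam_proj_right, dlam_proj_right, ← g_J_left_eq_dlam, ← g_J_left_eq_dlam] at this
  have e : ∑ k, wedgeHom (B.reebCoeffBar D k x) (B.thetaBar k x) = 0 := by
    refine complexification_ext₂ fun v w ↦ ?_
    simp only [LinearMap.sum_apply, wedgeHom_apply, wedge, Finset.sum_sub_distrib,
      B.sum_reebCoeffBar_mul_thetaBar h.riemannian hx]
    rw [s₁ v w, s₂ v w, sub_self]
    rfl
  have := LinearMap.congr_fun₂ e Z W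
  simpa only [LinearMap.sum_apply, wedgeHom_apply, LinearMap.zero_apply] using this

/-- A form `a` with `a(R) = 0` vanishes on type `(1,0)` exactly when `a ∘ J = -√-1 a`; moreover
`α_k` and its horizontal part agree on the image of `J`. -/
theorem isType01_alpha_iff (D : AffineConnection n M) (k : Fin n) (x : M) :
    T.IsType01 x (T.horizontal x (B.alpha D k x)) ↔ ∀ Z : TanC n x, B.alpha D k x (T.JC x Z) =
      -Complex.I * T.horizontal x (B.alpha D k x) Z + ((0 : ℝ) : ℂ) * B.theta k x Z := by
  have hJ : ∀ Z, T.horizontal x (B.alpha D k x) (T.JC x Z) = B.alpha D k x (T.JC x Z) := by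
    intro Z
    have := complexification_ext (f := (T.lamC x) ∘ₗ (T.JC x)) (g := 0) fun v ↦ by
      rw [LinearMap.comp_apply, JC_one_tmul, lamC_one_tmul, lam_J]
      simp
    have := LinearMap.congr_fun this Z
    rw [LinearMap.comp_apply, LinearMap.zero_apply] at this
    simp [ContactTriad.horizontal, this]
  have hR : T.horizontal x (B.alpha D k x) (T.reebC x) = 0 := by
    have : T.lamC x (T.reebC x) = 1 := by
      rw [reebC, lamC_one_tmul, lam_reeb, Complex.ofReal_one]
    simp [ContactTriad.horizontal, this]
  simp only [Complex.ofReal_zero, zero_mul, add_zero, ← hJ]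
  generalize T.horizontal x (B.alpha D k x) = a at hR
  constructor
  · intro h
    have := complexification_ext (f := a ∘ₗ T.JC x) (g := (-Complex.I) • a) fun v ↦ by
      have h₁ := h _ (T.xi10_mem (T.lam_proj x v))
      have h₂ : a ((1 : ℂ) ⊗ₜ[ℝ] T.proj x v) = a ((1 : ℂ) ⊗ₜ[ℝ] v) := by
        rw [proj, TensorProduct.tmul_sub, map_sub, one_tmul_smul, map_smul]
        exact (congrArg _ (congrArg _ hR)).trans (by rw [smul_zero, sub_zero])
      rw [map_sub, map_smul, J_proj, h₂, smul_eq_mul] at h₁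
      simp only [LinearMap.comp_apply, JC_one_tmul, LinearMap.smul_apply, smul_eq_mul]
      linear_combination Complex.I * h₁ + a ((1 : ℂ) ⊗ₜ[ℝ] T.J x v) * Complex.I_mul_I
    exact fun Z ↦ LinearMap.congr_fun this Z
  · intro h Z hZ
    have h₁ := h Z
    rw [show T.JC x Z = Complex.I • Z from hZ, map_smul, smul_eq_mul] at h₁
    have h₂ : (2 * Complex.I) * a Z = 0 := by linear_combination h₁
    exact (mul_eq_zero.1 h₂).resolve_left (by simp)

/-- The torsion conditions for an adapted connection, in real terms. -/
theorem torsionConditions_iff (h : T.IsAdapted D) (c : ℝ) : B.TorsionConditions c D ↔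
    ∀ x ∈ B.U, (∀ v, T.lam x v = 0 → D T.reeb x (T.J x v) + T.J x (D T.reeb x v) = c • v) ∧
      ∀ v, T.lam x v = 0 → T.proj x (D.torsion x (T.J x v) v) = 0 :=
  ⟨fun H x hx ↦ ⟨(B.alpha_iff h c hx).1 (H.alpha_part x hx),
    (B.vanishes11_Theta_iff hx).1 (H.xi_part x hx)⟩,
  fun H ↦ ⟨fun _ hx ↦ B.Theta0_eq h.riemannian hx,
    fun x hx ↦ (B.vanishes11_Theta_iff hx).2 (H x hx).2,
    fun x hx ↦ (B.alpha_iff h c hx).2 (H x hx).1⟩⟩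

theorem torsionConditions_zero_iff (h : T.IsAdapted D) :
    B.TorsionConditions 0 D ↔ B.TorsionConditionsZero D := by
  have hα : (∀ x ∈ B.U, ∀ k, T.IsType01 x (T.horizontal x (B.alpha D k x))) →
      ∀ x ∈ B.U, ∀ v, T.lam x v = 0 → D T.reeb x (T.J x v) + T.J x (D T.reeb x v) = 0 := by
    intro H x hx v hv
    rw [(B.alpha_iff h 0 hx).1 (fun k ↦ (B.isType01_alpha_iff D k x).1 (H x hx k)) v hv, zero_smul]
  constructor
  · intro H
    have H' : ∀ x ∈ B.U, ∀ k, T.IsType01 x (T.horizontal x (B.alpha D k x)) :=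
      fun x hx k ↦ (B.isType01_alpha_iff D k x).2 (H.alpha_part x hx k)
    refine ⟨fun x hx Z W ↦ ?_, H.xi_part, H'⟩
    rw [H.reeb_part x hx, Finset.sum_add_distrib, B.sum_wedge_bar_eq_zero h hx (hα H' x hx),
      add_zero]
  · exact fun H ↦ ⟨fun _ hx ↦ B.Theta0_eq h.riemannian hx, H.xi_part,
      fun x hx k ↦ (B.isType01_alpha_iff D k x).1 (H.alpha_part x hx k)⟩

end Frame

end ContactTriad

/-! ### Equivalence of the two descriptions, and the theorem. -/

namespace ContactTriad

variable {n : ℕ} {M : Type*} [TopologicalSpace M] [ChartedSpace (ModelE n) M]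
  [IsManifold (𝓡 (2 * n + 1)) ∞ M] {T : ContactTriad n M} {D : AffineConnection n M}

theorem IsContactTriadConnection.torsionConditions {c : ℝ} (h : T.IsContactTriadConnection c D)
    (B : T.Frame) : B.TorsionConditions c D :=
  (B.torsionConditions_iff h.isAdapted c).2 fun x _ ↦ ⟨h.cauchyRiemann x, h.torsion_xi x⟩

theorem isContactTriadConnection_iff (c : ℝ) : T.IsContactTriadConnection c D ↔
    T.IsAdapted D ∧ ∀ x : M, ∃ B : T.Frame, x ∈ B.U ∧ B.TorsionConditions c D := by
  refine ⟨fun h ↦ ⟨h.isAdapted, fun x ↦ ?_⟩, fun ⟨h, H⟩ ↦ ?_⟩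
  · obtain ⟨B, hx⟩ := T.exists_frame x
    exact ⟨B, hx, h.torsionConditions B⟩
  · have key : ∀ x, (∀ v, T.lam x v = 0 →
        D T.reeb x (T.J x v) + T.J x (D T.reeb x v) = c • v) ∧
        ∀ v, T.lam x v = 0 → T.proj x (D.torsion x (T.J x v) v) = 0 := fun x ↦ by
      obtain ⟨B, hx, hB⟩ := H x
      exact (B.torsionConditions_iff h c).1 hB x hx
    exact ⟨h.riemannian, h.cov_reeb_reeb, fun x v _ ↦ h.riemannian.lam_cov_reeb x v,
      fun x ↦ (key x).1, h.reeb_torsion, h.hermitian, fun x ↦ (key x).2⟩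

end ContactTriad

end

theorem theorem1p5 (n : ℕ) (M : Type*) [TopologicalSpace M] [T2Space M] [SigmaCompactSpace M]
    [ChartedSpace (ModelE n) M] [IsManifold (𝓡 (2 * n + 1)) ∞ M]
    (T : ContactTriad n M) (c : ℝ) :
    (∃ D : AffineConnection n M, D.IsSmooth ∧ T.IsAdapted D ∧
      (∀ B : T.Frame, B.TorsionConditions c D) ∧
      ∀ D' : AffineConnection n M, D'.IsSmooth → T.IsAdapted D' →
        (∀ x : M, ∃ B : T.Frame, x ∈ B.U ∧ B.TorsionConditions c D') → D'.Agrees D) ∧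
    (∀ D : AffineConnection n M, D.IsSmooth →
      ((T.IsAdapted D ∧ ∀ x : M, ∃ B : T.Frame, x ∈ B.U ∧ B.TorsionConditions c D) ↔
        T.IsContactTriadConnection c D)) ∧
    (∀ D : AffineConnection n M, D.IsSmooth → T.IsContactTriadConnection c D →
      ∀ B : T.Frame, ∀ x ∈ B.U, ∀ i, T.Vanishes20 x (B.Theta D i x)) ∧
    (∀ D : AffineConnection n M, D.IsSmooth → T.IsAdapted D →
      ∀ B : T.Frame, (B.TorsionConditions 0 D ↔ B.TorsionConditionsZero D)) := by
  refine ⟨?_, fun D _ ↦ (ContactTriad.isContactTriadConnection_iff c).symm, ?_, ?_⟩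
  · obtain ⟨D, hD, h⟩ := T.exists_contactTriadConnection c
    exact ⟨D, hD, h.isAdapted, h.torsionConditions, fun D' _ h' H' ↦
      ((ContactTriad.isContactTriadConnection_iff c).2 ⟨h', H'⟩).agrees h⟩
  · exact fun D _ h B x hx i ↦ B.vanishes20_Theta h.isAdapted hx (h.torsion_xi x) i
  · exact fun D _ h B ↦ B.torsionConditions_zero_iff h
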